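/- **Gauss–Legendre quadrature with $N/2+1$ nodes suffices for (optimized) $N$th-order commutator-free exponential time-propagators (CFETs).** Let $P_0=1$, $P_1(x)=2x-1$, $P_{n+1}(x)=\frac{2n+1}{n+1}(2x-1)P_n(x)-\frac{n}{n+1}P_{n-1}(x)$ be the shifted Legendre polynomials on $[0,1]$. For a function $A(t)$ that takes values in a unital Banach algebra (e.g. matrices) and has a power series expansion at $t=0$, and for small $\delta t>0$, put $$A_n=(2n-1)\int_0^{\delta t}A(t)\,P_{n-1}(t/\delta t)\,dt\qquad(n\ge 1),$$ and let $U$ be the propagator, $U'(t)=A(t)U(t)$ near $0$, $U(0)=1$. All $O$-estimates are for $\delta t\to0^+$. Let $N\ge 2$ be even and $M=N/2+1$. Real numbers $f_{i,n}$ ($1\le i\le s$, $1\le n\le M$) *define an $N$th-order CFET* if, for every size $d$ and every $d\times d$ complex matrix-valued $A(t)$ with a power series expansion at $0$, $$e^{\Omega_1}e^{\Omega_2}\cdots e^{\Omega_s}-U(\delta t)=O(\delta t^{N+1}),\qquad \Omega_i=\sum_{n=1}^{M}f_{i,n}A_n .$$ Let $x_1<\dots<x_M$ be the zeros of $P_M$,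 let $w_m=\int_0^1\prod_{k\ne m}\frac{x-x_k}{x_m-x_k}\,dx$ be the Gauss–Legendre weights on $[0,1]$, and put $$\hat A_n=(2n-1)\,\delta t\sum_{m=1}^{M}w_mP_{n-1}(x_m)A(x_m\delta t),\qquad g_{i,m}=w_m\sum_{n=1}^{M}(2n-1)P_{n-1}(x_m)f_{i,n},$$ so that replacing $A_n$ by $\hat A_n$ turns $\Omega_i$ into $\delta t\sum_{m=1}^{M}g_{i,m}A(x_m\delta t)$. Assume that the $f_{i,n}$ define an $N$th-order CFET. Then: 1. (Errors of the coefficients.) For every $A(t)$ as above, $\hat A_n-A_n=O(\delta t^{N+4-n})$ for $1\le n\le M$; in particular the error of $A_1,A_2$ is $O(\delta t^{N+2})$. The exponent is sharp: for every $n$ with $1\le n\le M$ there is a real-valued analytic $A(t)$ for which $\hat A_n-A_n$ is not $O(\delta t^{N+5-n})$. 2. (Contributing commutators.) Let $\tilde\Omega=\log(e^{\Omega_1}\cdots e^{\Omega_s})$ be the formal (Baker–Campbell–Hausdorff) exponent, a Lie series in noncommuting variables $A_1,\dots,A_M$. A multiset of indices $\{n_1,\dots,n_m\}$ contributes to $\tilde\Omega$,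 that is, some word in $A_{n_1},\dots,A_{n_m}$ (each used once, in any order) has a nonzero coefficient, only if $$n_k\le 1+\sum_{i\ne k}n_i\quad\text{for all }k=1,\dots,m. \qquad(\mathrm{P2})$$ 3. (Errors of the commutators.) For every nested commutator, with any bracketing, of $A_{n_1},\dots,A_{n_m}$ with $1\le n_k\le M$ whose indices satisfy (P2), and for every $A(t)$ as above, replacing all $A_n$ by $\hat A_n$ changes the commutator by $O(\delta t^{N+3})$. 4. (The CFET order is preserved.) For every $A(t)$ as above, $$\prod_{i=1}^{s}\exp\Big(\delta t\sum_{m=1}^{M}g_{i,m}A(x_m\delta t)\Big)-\prod_{i=1}^{s}\exp\Big(\sum_{n=1}^{M}f_{i,n}A_n\Big)=O(\delta t^{N+3})$$ (products ordered from left to right). Consequently the CFET with quadrature still differs from $U(\delta t)$ by $O(\delta t^{N+1})$, and for every integer $0\le p\le N+3$ it differs from $U(\delta t)$ by $O(\delta t^{p})$ if and only if the CFET with the exact $A_n$ does. -/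

import Mathlib

open Filter Topology Asymptotics
open scoped Nat

noncomputable section

namespace GaussCFET

/-- The shifted Legendre polynomials on `[0,1]`, by their three-term recurrence. -/
def legendre : ℕ → Polynomial ℝ
  | 0 => 1
  | 1 => 2 * Polynomial.X - 1
  | n + 2 =>
      Polynomial.C ((2 * ((n : ℝ) + 1) + 1) / ((n : ℝ) + 2))
          * ((2 * Polynomial.X - 1) * legendre (n + 1))
        - Polynomial.C (((n : ℝ) + 1) / ((n : ℝ) + 2)) * legendre n

/-- `M`-point Gauss-Legendre quadrature on `[0,1]`: the nodes are `M` distinct zeros of the `M`-th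
shifted Legendre polynomial (so all of them), in increasing order, and the weights are those of the
interpolatory rule with these nodes (the integrals of the Lagrange basis polynomials). -/
structure IsGaussLegendre (M : ℕ) (x w : Fin M → ℝ) : Prop where
  strictMono : StrictMono x
  root : ∀ m, (legendre M).eval (x m) = 0
  weight : ∀ m, w m = ∫ t in (0 : ℝ)..1, (Lagrange.basis Finset.univ x m).eval t

section Schemes

variable {𝔸 : Type*} [NormedRing 𝔸] [NormedAlgebra ℝ 𝔸]

/-- The Legendre coefficient `A_n` (`n ≥ 1`) of `A` on `[0, δ]`:
`A_n = (2n-1) ∫_0^δ P_{n-1}(t/δ) A(t) dt`. -/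
def legendreCoeff (A : ℝ → 𝔸) (n : ℕ) (δ : ℝ) : 𝔸 :=
  (2 * (n : ℝ) - 1) • ∫ t in (0 : ℝ)..δ, (legendre (n - 1)).eval (t / δ) • A t

/-- The coefficient `A_n` with the integral replaced by the quadrature rule `(x, w)`:
`(2n-1) δ ∑_m w_m P_{n-1}(x_m) A(x_m δ)`. -/
def quadCoeff {M : ℕ} (x w : Fin M → ℝ) (A : ℝ → 𝔸) (n : ℕ) (δ : ℝ) : 𝔸 :=
  ((2 * (n : ℝ) - 1) * δ) • ∑ m, (w m * (legendre (n - 1)).eval (x m)) • A (x m * δ)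

/-- The commutator-free product `exp Ω_1 ⋯ exp Ω_s` with `Ω_i = ∑_{n=1}^{M} f_{i,n} A_n`. -/
def cfet (M : ℕ) {s : ℕ} (f : Fin s → ℕ → ℝ) (A : ℝ → 𝔸) (δ : ℝ) : 𝔸 :=
  (List.ofFn fun i : Fin s =>
    NormedSpace.exp (∑ n ∈ Finset.Icc 1 M, f i n • legendreCoeff A n δ)).prod

/-- The coefficients `g_{i,m} = w_m ∑_{n=1}^{M} (2n-1) P_{n-1}(x_m) f_{i,n}`. -/
def quadWeight {M : ℕ} (x w : Fin M → ℝ) {s : ℕ} (f : Fin s → ℕ → ℝ) (i : Fin s) (m : Fin M) : ℝ :=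
  w m * ∑ n ∈ Finset.Icc 1 M, (2 * (n : ℝ) - 1) * (legendre (n - 1)).eval (x m) * f i n

/-- The quadrature version of the product, with factors `exp (δ ∑_m g_{i,m} A(x_m δ))`. -/
def quadCfet {M : ℕ} (x w : Fin M → ℝ) {s : ℕ} (f : Fin s → ℕ → ℝ) (A : ℝ → 𝔸) (δ : ℝ) : 𝔸 :=
  (List.ofFn fun i : Fin s =>
    NormedSpace.exp (δ • ∑ m, quadWeight x w f i m • A (x m * δ))).prod

/-- `U` is, near `0`, the propagator `U(t) = U(t, 0)`: `U' = A U` and `U(0) = 1`. -/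
def IsPropagator (A U : ℝ → 𝔸) : Prop :=
  U 0 = 1 ∧ ∀ᶠ t in 𝓝 (0 : ℝ), HasDerivAt U (A t * U t) t

/-- The value of a nested commutator (a binary bracketing of generators) under `n ↦ a n`. -/
def nestedComm (a : ℕ → 𝔸) : FreeMagma ℕ → 𝔸
  | .of n => a n
  | .mul b c => nestedComm a b * nestedComm a c - nestedComm a c * nestedComm a b

end Schemes

/-- The list of the generators in a nested commutator, with multiplicity. -/
def letters : FreeMagma ℕ → List ℕ
  | .of n => [n]
  | .mul b c => letters b ++ letters c

/-- No index `n` in the list exceeds the sum of the other indices by more than one. -/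
def IndexCondition (l : List ℕ) : Prop := ∀ n ∈ l, n ≤ 1 + (l.erase n).sum

section Order

attribute [local instance] Matrix.linftyOpNormedRing Matrix.linftyOpNormedAlgebra

/-- The real numbers `f_{i,n}`, `1 ≤ n ≤ N/2+1`, define a CFET of order `N`: for every size and every
matrix-valued `A` with a power series expansion at `0`, the product `exp Ω_1 ⋯ exp Ω_s` differs from
the exact propagator by `O(δ^{N+1})`. -/
def IsCFET (N : ℕ) {s : ℕ} (f : Fin s → ℕ → ℝ) : Prop :=
  ∀ (d : ℕ) (A U : ℝ → Matrix (Fin d) (Fin d) ℂ), AnalyticAt ℝ A 0 → IsPropagator A U →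
    (fun δ => cfet (N / 2 + 1) f A δ - U δ) =O[𝓝[>] (0 : ℝ)] fun δ => δ ^ (N + 1)

end Order

/-- Formal power series with real coefficients in noncommuting variables `a_n`; the value at the
list `[n_1, …, n_m]` is the coefficient of the word `a_{n_1} ⋯ a_{n_m}`. -/
abbrev WordSeries := List ℕ → ℝ

namespace WordSeries

def one : WordSeries := fun l => if l = [] then 1 else 0

def mul (S T : WordSeries) : WordSeries := fun l =>
  ∑ j ∈ Finset.range (l.length + 1), S (l.take j) * T (l.drop j)

def pow (S : WordSeries) : ℕ → WordSeries
  | 0 => one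
  | k + 1 => mul S (pow S k)

/-- `∑_k T^k / k!` for a series `T` without constant term (then `T^k` has no coefficient at words
shorter than `k`, so that the sum for a given word is finite). -/
def exp (T : WordSeries) : WordSeries := fun l =>
  ∑ k ∈ Finset.range (l.length + 1), pow T k l / (k ! : ℝ)

/-- `log S = ∑_{k ≥ 1} (-1)^{k+1} (S - 1)^k / k` for a series `S` with constant term `1`. -/
def log (S : WordSeries) : WordSeries := fun l =>
  ∑ k ∈ Finset.Icc 1 l.length, (-1) ^ (k + 1) / (k : ℝ) * pow (fun v => S v - one v) k l

/-- The linear series `∑_{n=1}^{M} c_n a_n`. -/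
def linear (M : ℕ) (c : ℕ → ℝ) : WordSeries
  | [n] => if 1 ≤ n ∧ n ≤ M then c n else 0
  | _ => 0

end WordSeries

/-- The formal exponent `Ω̃ = log (exp Ω_1 ⋯ exp Ω_s)`, `Ω_i = ∑_{n=1}^{M} f_{i,n} a_n`, of the
combined product (the Baker-Campbell-Hausdorff series), as a series in noncommuting `a_1, …, a_M`.
Its part of a given content (multiset of indices) is the sum of all its nested commutators with this
content, and it is zero iff all words with this content have coefficient zero. -/
def formalExponent (M : ℕ) {s : ℕ} (f : Fin s → ℕ → ℝ) : WordSeries :=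
  WordSeries.log ((List.ofFn fun i : Fin s => WordSeries.exp (WordSeries.linear M (f i))).foldr
    WordSeries.mul WordSeries.one)

end GaussCFET

end

noncomputable section

namespace GaussCFET

/-! Number the Taylor coefficient of `t^(j-1)` by `j`, so that it enters with weight `δ^j`.
Orthogonality of `P_{n-1}` to lower powers gives `A_n = O(δ^n)`. Gauss quadrature with `M = N/2+1`
nodes is exact below degree `2M = N+2` and fails in degree `2M`, so the error of `A_n` is exactly of
order `N+4-n` in general (`quadSum_eq`, `quadSum_ne`).

Large `n` thus have large errors, and what saves the order is (P2). In a word or commutator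
satisfying (P2), the letters other than a given `A_n` contribute at least `δ^(n-1)`, so replacing
that `A_n` costs `O(δ^(N+3))`.

It remains to see that only words satisfying (P2) occur. Testing the CFET on nilpotent matrices
shows that, in the Taylor variables, the product of exponentials has the coefficients of the Dyson
series on all words of weight at most `N` (`IsCFET.prodExp_eq_dyson`). The passage to the Legendre
variables is a triangular linear substitution. It turns Dyson coefficients into iterated integrals
of Legendre polynomials over `[0,1]`. If one index `n` violates (P2), integration by parts collects
the other factors in a polynomial of degree less than `n-1`, and orthogonality makes the integral
zero (`eval_one_legendreIterated_eq_zero`). As `n ≤ N/2+1`, a violating word has weight at most `N`,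
so the order conditions cover every violating word (`IsCFET.prodExp_eq_zero`).

The logarithm inherits the vanishing, because a too large index stays too large in any subword
containing it. The estimate for the CFET itself needs no logarithm: the product is expanded into
words of length at most `N+2`, and the words are compared one by one. -/

open Polynomial in
/-- Integration of a polynomial over `[0, 1]`, as a linear functional. -/
def unitIntegral : ℝ[X] →ₗ[ℝ] ℝ where
  toFun p := ∫ t in (0 : ℝ)..1, p.eval t
  map_add' p q := by
    simp only [eval_add]
    exact intervalIntegral.integral_add (p.continuous.intervalIntegrable _ _)
      (q.continuous.intervalIntegrable _ _)
  map_smul' c p := by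
    simp only [eval_smul, RingHom.id_apply]
    exact intervalIntegral.integral_smul c _

/-! ### Shifted Legendre polynomials: orthogonality and norms. -/

section Legendre

open Polynomial

theorem unitIntegral_apply (p : ℝ[X]) : unitIntegral p = ∫ t in (0 : ℝ)..1, p.eval t := rfl

theorem unitIntegral_derivative (p : ℝ[X]) :
    unitIntegral (derivative p) = p.eval 1 - p.eval 0 :=
  intervalIntegral.integral_eq_sub_of_hasDerivAt (fun t _ => p.hasDerivAt t)
    ((derivative p).continuous.intervalIntegrable _ _)

theorem unitIntegral_C_mul (c : ℝ) (p : ℝ[X]) : unitIntegral (C c * p) = c * unitIntegral p := by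
  rw [← smul_eq_C_mul, map_smul, smul_eq_mul]

theorem legendre_succ_succ (n : ℕ) :
    C ((n : ℝ) + 2) * legendre (n + 2) =
      C (2 * (n : ℝ) + 3) * ((2 * X - 1) * legendre (n + 1)) - C ((n : ℝ) + 1) * legendre n := by
  have h : (n : ℝ) + 2 ≠ 0 := by positivity
  have h1 : (2 * (n : ℝ) + 3) = ((n : ℝ) + 2) * ((2 * ((n : ℝ) + 1) + 1) / ((n : ℝ) + 2)) := by
    field_simp
    ring
  have h2 : ((n : ℝ) + 1) = ((n : ℝ) + 2) * (((n : ℝ) + 1) / ((n : ℝ) + 2)) := by field_simp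
  rw [legendre, h1, C_mul]
  conv_rhs => rw [h2, C_mul]
  rw [← h2]
  ring

theorem natDegree_legendre_le (n : ℕ) : (legendre n).natDegree ≤ n := by
  induction n using Nat.twoStepInduction with
  | zero => simp [legendre]
  | one => rw [legendre]; compute_degree
  | more n h1 h2 =>
    rw [legendre]
    have h3 : (2 * X - 1 : ℝ[X]).natDegree ≤ 1 := by compute_degree
    refine (natDegree_sub_le _ _).trans (max_le ?_ ?_)
    · refine (natDegree_C_mul_le _ _).trans (natDegree_mul_le.trans ?_)
      omega
    · exact (natDegree_C_mul_le _ _).trans (by omega)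

theorem coeff_legendre_pos (n : ℕ) : 0 < (legendre n).coeff n := by
  induction n using Nat.twoStepInduction with
  | zero => simp [legendre]
  | one => simp [legendre, coeff_one, coeff_X, coeff_ofNat_mul]
  | more n h1 h2 =>
    have h3 : (legendre n).coeff (n + 2) = 0 :=
      coeff_eq_zero_of_natDegree_lt ((natDegree_legendre_le n).trans_lt (by omega))
    have h4 : (legendre (n + 1)).coeff (n + 2) = 0 :=
      coeff_eq_zero_of_natDegree_lt ((natDegree_legendre_le _).trans_lt (by omega))
    rw [legendre, coeff_sub, coeff_C_mul, coeff_C_mul, h3, sub_mul, one_mul, coeff_sub, h4,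
      mul_assoc, coeff_ofNat_mul, coeff_X_mul]
    simp only [mul_zero, sub_zero]
    positivity

theorem natDegree_legendre (n : ℕ) : (legendre n).natDegree = n :=
  natDegree_eq_of_le_of_coeff_ne_zero (natDegree_legendre_le n) (coeff_legendre_pos n).ne'

/-- Neither relation closes an induction alone: the next first relation comes from the
differentiated recurrence and the present second one, and the next second relation then uses both
present ones. The differential equation and the norms rest on this pair. -/
theorem legendre_derivative_relations (n : ℕ) :
    derivative (legendre (n + 1)) = (2 * X - 1) * derivative (legendre n)
        + C (2 * ((n : ℝ) + 1)) * legendre n ∧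
      (2 * X - 1) * derivative (legendre (n + 1)) = derivative (legendre n)
        + C (2 * ((n : ℝ) + 1)) * legendre (n + 1) := by
  induction n with
  | zero =>
    have h : (C (2 : ℝ)) = (2 : ℝ[X]) := rfl
    constructor <;> simp [legendre, h]; ring
  | succ n ih =>
    obtain ⟨ha, hb⟩ := ih
    have hr := legendre_succ_succ n
    have hd := congrArg derivative hr
    have hn : C ((n : ℝ) + 2) ≠ 0 := C_ne_zero.2 (by positivity)
    simp only [derivative_sub, derivative_mul, derivative_C, derivative_ofNat, derivative_X,
      derivative_one, zero_mul, zero_add, mul_one, sub_zero] at hd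
    simp only [C_add, C_mul, C_ofNat, C_1, Nat.cast_add, Nat.cast_one] at *
    set k : ℝ[X] := C (n : ℝ)
    have ha' : derivative (legendre (n + 2)) = (2 * X - 1) * derivative (legendre (n + 1))
        + 2 * (k + 1 + 1) * legendre (n + 1) := by
      refine mul_left_cancel₀ hn ?_
      linear_combination hd + (k + 1) * hb
    refine ⟨ha', ?_⟩
    linear_combination (2 * X - 1) * ha' + (2 * X - 1) * hb - ha - 2 * hr

theorem legendre_differential_equation (n : ℕ) :
    derivative ((1 - (2 * X - 1) ^ 2) * derivative (legendre n))
      = C (-4 * (n : ℝ) * (n + 1)) * legendre n := by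
  cases n with
  | zero => simp [legendre]
  | succ n =>
    obtain ⟨ha, hb⟩ := legendre_derivative_relations n
    have h : (1 - (2 * X - 1) ^ 2) * derivative (legendre (n + 1))
        = C (2 * ((n : ℝ) + 1)) * (legendre n - (2 * X - 1) * legendre (n + 1)) := by
      linear_combination ha - (2 * X - 1) * hb
    rw [h]
    simp only [derivative_sub, derivative_mul, derivative_C, derivative_ofNat, derivative_X,
      derivative_one, zero_mul, zero_add, mul_one, sub_zero]
    simp only [C_add, C_mul, C_neg, C_ofNat, C_1, Nat.cast_add, Nat.cast_one] at *
    linear_combination (-2 * (C (n : ℝ) + 1)) * hb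

/-- Self-adjointness of the Legendre operator, tested on `X ^ k`. The Wronskian boundary term drops
out because `1 - (2X-1)^2` vanishes at `0` and `1`, and the operator maps `X ^ k` to a combination
of `X ^ k` and `X ^ (k-1)`. -/
theorem legendre_moment_recursion (n k : ℕ) :
    ((k : ℝ) * (k + 1) - n * (n + 1)) * unitIntegral (legendre n * X ^ k)
      = (k : ℝ) ^ 2 * unitIntegral (legendre n * X ^ (k - 1)) := by
  have h1 := unitIntegral_derivative
    ((1 - (2 * X - 1) ^ 2) * (derivative (legendre n) * X ^ k - legendre n * derivative (X ^ k)))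
  have h2 : derivative ((1 - (2 * X - 1) ^ 2) *
      (derivative (legendre n) * X ^ k - legendre n * derivative (X ^ k)))
      = C (-4 * (n : ℝ) * (n + 1)) * (legendre n * X ^ k)
        - C (4 * (k : ℝ) ^ 2) * (legendre n * X ^ (k - 1))
        + C (4 * (k : ℝ) * (k + 1)) * (legendre n * X ^ k) := by
    have h3 : derivative ((1 - (2 * X - 1) ^ 2) * derivative (X ^ k : ℝ[X]))
        = C (4 * (k : ℝ) ^ 2) * X ^ (k - 1) - C (4 * (k : ℝ) * (k + 1)) * X ^ k := by
      have h4 : (1 - (2 * X - 1) ^ 2) * derivative (X ^ k : ℝ[X])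
          = C (4 * (k : ℝ)) * (X ^ k - X ^ (k + 1)) := by
        cases k with
        | zero => simp
        | succ k =>
          simp only [derivative_X_pow, Nat.add_sub_cancel, C_mul, C_ofNat]
          ring
      rw [h4, derivative_C_mul, derivative_sub, derivative_X_pow, derivative_X_pow]
      simp only [Nat.add_sub_cancel, C_mul, C_add, C_ofNat, C_1, Nat.cast_add, Nat.cast_one, C_pow]
      ring
    have h5 := legendre_differential_equation n
    have h6 : (1 - (2 * X - 1) ^ 2) *
        (derivative (legendre n) * X ^ k - legendre n * derivative (X ^ k))
        = ((1 - (2 * X - 1) ^ 2) * derivative (legendre n)) * X ^ k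
          - legendre n * ((1 - (2 * X - 1) ^ 2) * derivative (X ^ k)) := by ring
    rw [h6, derivative_sub, derivative_mul, h5, derivative_mul, h3]
    ring
  rw [h2] at h1
  simp only [map_add, map_sub, unitIntegral_C_mul, eval_mul, eval_sub, eval_pow, eval_X, eval_one,
    eval_ofNat] at h1
  linarith

/-- The factor `k(k+1) - n(n+1)` of the recursion is nonzero for `k < n`, and the recursion starts
with right-hand side `0` at `k = 0`. -/
theorem unitIntegral_legendre_mul_X_pow {n k : ℕ} (h : k < n) :
    unitIntegral (legendre n * X ^ k) = 0 := by
  have key : ∀ j : ℕ, j < n → ((j : ℝ) * (j + 1) - n * (n + 1)) ≠ 0 := fun j hj => by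
    have : (j : ℝ) < n := by exact_mod_cast hj
    have hj0 : (0 : ℝ) ≤ j := by positivity
    nlinarith
  induction k with
  | zero =>
    have := legendre_moment_recursion n 0
    simpa [(Nat.pos_iff_ne_zero.1 h)] using
      (mul_eq_zero.1 (this.trans (by simp))).resolve_left (key 0 h)
  | succ k ih =>
    have := legendre_moment_recursion n (k + 1)
    rw [Nat.add_sub_cancel, ih (by omega), mul_zero] at this
    exact (mul_eq_zero.1 this).resolve_left (key _ h)

theorem unitIntegral_legendre_mul {n : ℕ} {q : ℝ[X]} (h : q.natDegree < n) :
    unitIntegral (legendre n * q) = 0 := by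
  rw [q.as_sum_range_C_mul_X_pow, Finset.mul_sum, map_sum]
  refine Finset.sum_eq_zero fun k hk => ?_
  rw [mul_left_comm, unitIntegral_C_mul, unitIntegral_legendre_mul_X_pow, mul_zero]
  have := Finset.mem_range.1 hk
  omega

theorem eval_one_legendre (n : ℕ) : (legendre n).eval 1 = 1 := by
  induction n using Nat.twoStepInduction with
  | zero => simp [legendre]
  | one => simp [legendre]; norm_num
  | more n h1 h2 =>
    simp only [legendre, eval_sub, eval_mul, eval_C, eval_X, eval_ofNat, eval_one, h1, h2]
    field_simp
    ring

theorem eval_zero_legendre (n : ℕ) : (legendre n).eval 0 = (-1) ^ n := by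
  induction n using Nat.twoStepInduction with
  | zero => simp [legendre]
  | one => simp [legendre]
  | more n h1 h2 =>
    simp only [legendre, eval_sub, eval_mul, eval_C, eval_X, eval_ofNat, eval_one, h1, h2]
    field_simp
    ring

theorem unitIntegral_legendre_sq (n : ℕ) :
    (2 * (n : ℝ) + 1) * unitIntegral (legendre n * legendre n) = 1 := by
  cases n with
  | zero => simp [legendre, unitIntegral_apply]
  | succ n =>
    -- The boundary values of `(2X-1) P²` at `1` and `0` are `1` and `-1`; the derivative is a
    -- multiple of `P²` plus a term killed by orthogonality.
    have h1 := unitIntegral_derivative ((2 * X - 1) * (legendre (n + 1) * legendre (n + 1)))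
    have h2 : derivative ((2 * X - 1) * (legendre (n + 1) * legendre (n + 1)))
        = C 2 * (legendre (n + 1) * legendre (n + 1))
          + C 2 * (legendre (n + 1) * derivative (legendre n))
          + C (4 * ((n : ℝ) + 1)) * (legendre (n + 1) * legendre (n + 1)) := by
      have h3 := (legendre_derivative_relations n).2
      simp only [derivative_sub, derivative_mul, derivative_ofNat, derivative_X,
        derivative_one, zero_mul, zero_add, mul_one, sub_zero]
      simp only [C_mul, C_ofNat] at *
      linear_combination (2 * legendre (n + 1)) * h3
    have h4 : unitIntegral (legendre (n + 1) * derivative (legendre n)) = 0 :=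
      unitIntegral_legendre_mul ((natDegree_derivative_le _).trans_lt
        (by rw [natDegree_legendre]; omega))
    rw [h2] at h1
    simp only [map_add, unitIntegral_C_mul, h4, eval_mul, eval_sub, eval_X, eval_one, eval_ofNat,
      eval_one_legendre, eval_zero_legendre, ← pow_add, ← two_mul, pow_mul] at h1
    push_cast
    norm_num at h1
    linarith

theorem unitIntegral_legendre_mul_legendre {m n : ℕ} (h : m ≠ n) :
    unitIntegral (legendre m * legendre n) = 0 := by
  rcases h.lt_or_gt with h | h
  · rw [mul_comm]
    exact unitIntegral_legendre_mul (by rwa [natDegree_legendre])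
  · exact unitIntegral_legendre_mul (by rwa [natDegree_legendre])

/-! ### Exactness of Gauss–Legendre quadrature and its failure in degree `2M`. -/

/-- Evaluation of a quadrature rule on a polynomial. -/
def quadSum {M : ℕ} (x w : Fin M → ℝ) (q : ℝ[X]) : ℝ := ∑ m, w m * q.eval (x m)

namespace IsGaussLegendre

variable {M : ℕ} {x w : Fin M → ℝ}

theorem legendre_eq (h : IsGaussLegendre M x w) :
    legendre M = C ((legendre M).coeff M) * Lagrange.nodal Finset.univ x := by
  have hd : (Lagrange.nodal Finset.univ x).natDegree = M := by
    rw [Lagrange.natDegree_nodal, Finset.card_univ, Fintype.card_fin]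
  have hm : (Lagrange.nodal Finset.univ x).Monic := Lagrange.nodal_monic
  refine Polynomial.eq_of_degree_sub_lt_of_eval_finset_eq (Finset.univ.image x) ?_ ?_
  · rw [Finset.card_image_of_injective _ h.strictMono.injective, Finset.card_univ, Fintype.card_fin]
    refine (degree_lt_iff_coeff_zero _ _).2 fun k hk => ?_
    rw [coeff_sub, coeff_C_mul]
    rcases hk.eq_or_lt with rfl | hk
    · have : (Lagrange.nodal Finset.univ x).coeff M = 1 := by
        have := hm.coeff_natDegree
        rwa [hd] at this
      rw [this, mul_one, sub_self]
    · rw [coeff_eq_zero_of_natDegree_lt (by rwa [natDegree_legendre]),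
        coeff_eq_zero_of_natDegree_lt (p := Lagrange.nodal _ _) (by rwa [hd]), mul_zero, sub_zero]
  · simp only [Finset.mem_image, Finset.mem_univ, true_and, forall_exists_index,
      forall_apply_eq_imp_iff]
    intro m
    rw [h.root, eval_mul, Lagrange.eval_nodal_at_node (Finset.mem_univ m), mul_zero]

theorem unitIntegral_nodal_mul (h : IsGaussLegendre M x w) {q : ℝ[X]} (hq : q.natDegree < M) :
    unitIntegral (Lagrange.nodal Finset.univ x * q) = 0 := by
  have h1 := unitIntegral_legendre_mul hq
  rw [h.legendre_eq, mul_assoc, unitIntegral_C_mul] at h1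
  exact (mul_eq_zero.1 h1).resolve_left (coeff_legendre_pos M).ne'

theorem unitIntegral_nodal_sq_ne_zero (h : IsGaussLegendre M x w) :
    unitIntegral (Lagrange.nodal Finset.univ x * Lagrange.nodal Finset.univ x) ≠ 0 := by
  intro h0
  have h1 := unitIntegral_legendre_sq M
  rw [h.legendre_eq, mul_assoc, unitIntegral_C_mul, mul_left_comm (Lagrange.nodal _ _),
    unitIntegral_C_mul, h0] at h1
  simp at h1

theorem quadSum_nodal_mul (q : ℝ[X]) : quadSum x w (Lagrange.nodal Finset.univ x * q) = 0 :=
  Finset.sum_eq_zero fun m _ => by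
    rw [eval_mul, Lagrange.eval_nodal_at_node (Finset.mem_univ m), zero_mul, mul_zero]

theorem quadSum_of_degree_lt (h : IsGaussLegendre M x w) {q : ℝ[X]} (hq : q.degree < M) :
    quadSum x w q = unitIntegral q := by
  have h1 := Lagrange.eq_interpolate_of_eval_eq (s := Finset.univ) (v := x)
    (fun m => q.eval (x m)) h.strictMono.injective.injOn (by simpa using hq) fun _ _ => rfl
  conv_rhs => rw [h1, Lagrange.interpolate_apply, map_sum]
  refine Finset.sum_congr rfl fun m _ => ?_
  rw [unitIntegral_C_mul, h.weight m, unitIntegral_apply, mul_comm]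

theorem quadSum_add (p q : ℝ[X]) : quadSum x w (p + q) = quadSum x w p + quadSum x w q := by
  simp only [quadSum, eval_add, mul_add, Finset.sum_add_distrib]

theorem quadSum_C_mul (c : ℝ) (p : ℝ[X]) : quadSum x w (C c * p) = c * quadSum x w p := by
  simp only [quadSum, eval_mul, eval_C, Finset.mul_sum]
  exact Finset.sum_congr rfl fun _ _ => by ring

/-- Division by the nodal polynomial leaves a remainder of degree below `M`, where the interpolatory
rule is exact. The nodal multiple is zero at the nodes, and its integral vanishes by orthogonality
since the quotient has degree below `M`. -/
theorem quadSum_eq (h : IsGaussLegendre M x w) {q : ℝ[X]} (hq : q.natDegree < 2 * M) :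
    quadSum x w q = unitIntegral q := by
  have hm : (Lagrange.nodal Finset.univ x).Monic := Lagrange.nodal_monic
  have hd : (Lagrange.nodal Finset.univ x).natDegree = M := by
    rw [Lagrange.natDegree_nodal, Finset.card_univ, Fintype.card_fin]
  rw [← modByMonic_add_div q (Lagrange.nodal Finset.univ x), quadSum_add, quadSum_nodal_mul,
    map_add, h.unitIntegral_nodal_mul, h.quadSum_of_degree_lt]
  · have := degree_modByMonic_lt q hm
    rwa [degree_eq_natDegree hm.ne_zero, hd] at this
  · rw [natDegree_divByMonic _ hm, hd]
    omega

/-- Subtracting a multiple of the squared nodal polynomial reduces to the exact range; the rule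
gives `0` on that square, but its integral is nonzero. -/
theorem quadSum_ne (h : IsGaussLegendre M x w) (hM : M ≠ 0) {q : ℝ[X]}
    (hq : q.natDegree = 2 * M) : quadSum x w q - unitIntegral q ≠ 0 := by
  have hm : (Lagrange.nodal Finset.univ x).Monic := Lagrange.nodal_monic
  have hd : (Lagrange.nodal Finset.univ x).natDegree = M := by
    rw [Lagrange.natDegree_nodal, Finset.card_univ, Fintype.card_fin]
  have hq0 : q.leadingCoeff ≠ 0 := fun h0 => by
    rw [leadingCoeff_eq_zero.1 h0, natDegree_zero] at hq
    omega
  set p : ℝ[X] := C q.leadingCoeff *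
    (Lagrange.nodal Finset.univ x * Lagrange.nodal Finset.univ x) with hp
  have hpd : p.natDegree = 2 * M := by
    rw [hp, natDegree_C_mul hq0, hm.natDegree_mul hm, hd, two_mul]
  have hlt : (q - p).natDegree < 2 * M := by
    have hl : q.leadingCoeff = p.leadingCoeff := by
      rw [hp, leadingCoeff_mul, leadingCoeff_C, (hm.mul hm).leadingCoeff, mul_one]
    have hp0 : p ≠ 0 := leadingCoeff_ne_zero.1 (hl ▸ hq0)
    have h1 := degree_sub_lt_left (by rw [degree_eq_natDegree (leadingCoeff_ne_zero.1 hq0),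
      degree_eq_natDegree hp0, hq, hpd]) (leadingCoeff_ne_zero.1 hq0) hl
    rw [degree_eq_natDegree (leadingCoeff_ne_zero.1 hq0), hq] at h1
    by_cases h0 : q - p = 0
    · rw [h0, natDegree_zero]
      omega
    · exact (natDegree_lt_iff_degree_lt h0).2 h1
  have h1 := h.quadSum_eq hlt
  have h2 : q = (q - p) + p := by ring
  rw [h2, quadSum_add, map_add, h1, hp, quadSum_C_mul, quadSum_nodal_mul, unitIntegral_C_mul]
  simpa using ⟨leadingCoeff_ne_zero.1 hq0, h.unitIntegral_nodal_sq_ne_zero⟩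

end IsGaussLegendre

end Legendre

/-! ### Calculus of orders of smallness. -/

section Order

variable {E 𝔸 : Type*} [NormedAddCommGroup E] [NormedRing 𝔸]

/-- `F(δ) = O(δ^k)` as `δ → 0⁺`. -/
def HasOrder (F : ℝ → E) (k : ℕ) : Prop := F =O[𝓝[>] (0 : ℝ)] fun δ => δ ^ k

namespace HasOrder

variable {F G : ℝ → E} {k m : ℕ}

theorem mono (h : HasOrder F k) (hm : m ≤ k) : HasOrder F m := by
  refine IsBigO.trans h (IsBigO.of_bound 1 ?_)
  filter_upwards [Ioo_mem_nhdsGT (zero_lt_one' ℝ)] with δ hδ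
  rw [one_mul, norm_pow, norm_pow, Real.norm_of_nonneg hδ.1.le]
  exact pow_le_pow_of_le_one hδ.1.le hδ.2.le hm

theorem add (hF : HasOrder F k) (hG : HasOrder G k) : HasOrder (fun δ => F δ + G δ) k :=
  IsBigO.add hF hG

theorem sub (hF : HasOrder F k) (hG : HasOrder G k) : HasOrder (fun δ => F δ - G δ) k :=
  IsBigO.sub hF hG

theorem smul_const [NormedSpace ℝ E] (hF : HasOrder F k) (c : ℝ) : HasOrder (fun δ => c • F δ) k :=
  IsBigO.const_smul_left hF c

theorem zero : HasOrder (fun _ => (0 : E)) k := isBigO_zero _ _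

theorem const (c : E) : HasOrder (fun _ => c) 0 := by
  simpa [HasOrder] using isBigO_const_const c (one_ne_zero (α := ℝ)) (𝓝[>] (0 : ℝ))

theorem sum {ι : Type*} {s : Finset ι} {F : ι → ℝ → E} (h : ∀ i ∈ s, HasOrder (F i) k) :
    HasOrder (fun δ => ∑ i ∈ s, F i δ) k :=
  IsBigO.fun_sum h

theorem mul {F G : ℝ → 𝔸} (hF : HasOrder F k) (hG : HasOrder G m) :
    HasOrder (fun δ => F δ * G δ) (k + m) := by
  simpa only [HasOrder, pow_add] using IsBigO.mul hF hG

theorem pow_smul_const [NormedSpace ℝ E] (c : E) : HasOrder (fun δ : ℝ => δ ^ k • c) k := by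
  simpa [HasOrder] using
    IsBigO.smul (isBigO_refl (fun δ : ℝ => δ ^ k) (𝓝[>] 0))
      (isBigO_const_const c (one_ne_zero (α := ℝ)) _)

theorem congr_left (hF : HasOrder F k) (h : ∀ δ, 0 < δ → F δ = G δ) : HasOrder G k :=
  IsBigO.congr' hF (eventually_nhdsWithin_of_forall h) EventuallyEq.rfl

theorem tendsto_zero (hF : HasOrder F k) (hk : k ≠ 0) : Tendsto F (𝓝[>] 0) (𝓝 0) := by
  refine IsBigO.trans_tendsto hF ?_
  have : Tendsto (fun δ : ℝ => δ ^ k) (𝓝 0) (𝓝 0) := by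
    simpa [hk] using (continuous_pow k).tendsto (0 : ℝ)
  exact this.mono_left nhdsWithin_le_nhds

theorem pow_sub_pow {F G : ℝ → 𝔸} (hF : HasOrder F 0) (hG : HasOrder G 0)
    (h : HasOrder (fun δ => F δ - G δ) k) (i : ℕ) : HasOrder (fun δ => F δ ^ i - G δ ^ i) k := by
  have hp : ∀ i, HasOrder (fun δ => G δ ^ i) 0 := fun i => by
    induction i with
    | zero => simpa using const (1 : 𝔸)
    | succ i ih => simpa only [pow_succ] using ih.mul hG
  induction i with
  | zero => simpa using zero
  | succ i ih =>
    have h1 := (ih.mul hF).add (((hp i).mul h).mono (by omega))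
    refine h1.congr_left fun δ _ => ?_
    rw [pow_succ, pow_succ]
    noncomm_ring

end HasOrder

theorem hasOrder_exp_sub_sum [NormedAlgebra ℝ 𝔸] [CompleteSpace 𝔸] {Ω : ℝ → 𝔸} (hΩ : HasOrder Ω 1) (k : ℕ) :
    HasOrder (fun δ => NormedSpace.exp (Ω δ)
      - ∑ i ∈ Finset.range k, ((i ! : ℝ)⁻¹) • Ω δ ^ i) k := by
  have h1 := (NormedSpace.exp_hasFPowerSeriesAt_zero (𝕂 := ℝ)
    (𝔸 := 𝔸)).isBigO_sub_partialSum_pow k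
  have h2 := (h1.comp_tendsto (hΩ.tendsto_zero one_ne_zero)).trans
    (IsBigO.pow (IsBigO.norm_left hΩ) k)
  simpa [HasOrder, Function.comp_def, FormalMultilinearSeries.partialSum,
    NormedSpace.expSeries_apply_eq] using h2

end Order

/-! ### Noncommutative word series and their truncated values. -/

namespace WordSeries

theorem mul_nil (S T : WordSeries) : mul S T [] = S [] * T [] := by
  simp [mul]

/-- Stripping the first letter acts on products like a derivation twisted by the constant term. With
the Horner form of `evalTrunc`, this drives the inductions below. -/
theorem mul_cons (S T : WordSeries) (n : ℕ) (v : List ℕ) :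
    mul S T (n :: v) = S [] * T (n :: v) + mul (fun l => S (n :: l)) T v := by
  simp only [mul, List.length_cons]
  rw [Finset.sum_range_succ', add_comm]
  simp

theorem one_mul (T : WordSeries) : mul one T = T := by
  funext l
  cases l with
  | nil => simp [mul_nil, one]
  | cons n v =>
    rw [mul_cons]
    simp [one, mul]

theorem mul_const_left (c : ℝ) (S T : WordSeries) :
    mul (fun l => c * S l) T = fun l => c * mul S T l := by
  funext l
  simp only [mul, Finset.mul_sum, mul_assoc]

theorem linear_cons (M : ℕ) (c : ℕ → ℝ) (n : ℕ) :
    (fun v => linear M c (n :: v)) = fun v => (if 1 ≤ n ∧ n ≤ M then c n else 0) * one v := by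
  funext v
  cases v <;> simp [linear, one]

theorem pow_linear (M : ℕ) (c : ℕ → ℝ) (k : ℕ) (l : List ℕ) :
    pow (linear M c) k l = if l.length = k then
      (l.map fun n => if 1 ≤ n ∧ n ≤ M then c n else 0).prod else 0 := by
  induction k generalizing l with
  | zero => cases l <;> simp [pow, one]
  | succ k ih =>
    cases l with
    | nil => simp [pow, mul_nil, linear]
    | cons n v =>
      rw [pow, mul_cons, linear_cons, mul_const_left, one_mul]
      by_cases hn : 1 ≤ n ∧ n ≤ M <;> simp [linear, hn, ih]

theorem exp_linear (M : ℕ) (c : ℕ → ℝ) (l : List ℕ) :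
    exp (linear M c) l =
      (l.map fun n => if 1 ≤ n ∧ n ≤ M then c n else 0).prod / (l.length ! : ℝ) := by
  rw [exp, Finset.sum_eq_single l.length]
  · simp [pow_linear]
  · intro k _ hk
    rw [pow_linear, if_neg (Ne.symm hk), zero_div]
  · simp

/-- The product of the exponentials of linear series. -/
def prodExp (M : ℕ) {s : ℕ} (f : Fin s → ℕ → ℝ) : WordSeries :=
  (List.ofFn fun i : Fin s => exp (linear M (f i))).foldr mul one

variable {𝔸 : Type*} [NormedRing 𝔸] [NormedAlgebra ℝ 𝔸]

/-- The value of the truncation of a word series to words of length at most `k` in the letters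
`1, …, M`. -/
def evalTrunc (M : ℕ) : ℕ → WordSeries → (ℕ → 𝔸) → 𝔸
  | 0, T, _ => T [] • 1
  | k + 1, T, a => T [] • 1 + ∑ n ∈ Finset.Icc 1 M, a n * evalTrunc M k (fun l => T (n :: l)) a

theorem evalTrunc_add (M k : ℕ) (S T : WordSeries) (a : ℕ → 𝔸) :
    evalTrunc M k (fun l => S l + T l) a = evalTrunc M k S a + evalTrunc M k T a := by
  induction k generalizing S T with
  | zero => simp [evalTrunc, add_smul]
  | succ k ih =>
    simp only [evalTrunc, ih, add_smul, mul_add, Finset.sum_add_distrib]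
    abel

theorem evalTrunc_const_mul (M k : ℕ) (c : ℝ) (T : WordSeries) (a : ℕ → 𝔸) :
    evalTrunc M k (fun l => c * T l) a = c • evalTrunc M k T a := by
  induction k generalizing T with
  | zero => simp [evalTrunc, mul_smul]
  | succ k ih =>
    simp only [evalTrunc, ih, mul_smul, smul_add, Finset.smul_sum, mul_smul_comm]

theorem evalTrunc_zero_series (M k : ℕ) (a : ℕ → 𝔸) :
    evalTrunc M k (fun _ => 0) a = 0 := by
  induction k with
  | zero => simp [evalTrunc]
  | succ k ih => simp [evalTrunc, ih]

theorem evalTrunc_one (M k : ℕ) (a : ℕ → 𝔸) : evalTrunc M k one a = 1 := by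
  cases k with
  | zero => simp [evalTrunc, one]
  | succ k => simp [evalTrunc, one, evalTrunc_zero_series]

/-- The value of a shifted exponential of a linear series is a partial sum of the exponential
series. -/
theorem evalTrunc_exp_shift (M k j : ℕ) (c : ℕ → ℝ) (a : ℕ → 𝔸) :
    evalTrunc M k (fun l => (l.map fun n => if 1 ≤ n ∧ n ≤ M then c n else 0).prod /
        ((l.length + j)! : ℝ)) a =
      ∑ i ∈ Finset.range (k + 1), (((i + j)! : ℝ)⁻¹) • (∑ n ∈ Finset.Icc 1 M, c n • a n) ^ i := by
  induction k generalizing j with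
  | zero => simp [evalTrunc]
  | succ k ih =>
    -- Stripping a letter replaces the shift `j` of the factorial by `j + 1`, which is why `j` is
    -- kept general.
    rw [Finset.sum_range_succ', evalTrunc, add_comm]
    congr 1
    · have h : ∀ n ∈ Finset.Icc 1 M, a n * evalTrunc M k (fun l =>
          ((n :: l).map fun n => if 1 ≤ n ∧ n ≤ M then c n else 0).prod /
          (((n :: l).length + j)! : ℝ)) a = (c n • a n) *
          ∑ i ∈ Finset.range (k + 1), (((i + (j + 1))! : ℝ)⁻¹) •
            (∑ n ∈ Finset.Icc 1 M, c n • a n) ^ i := fun n hn => by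
        rw [← ih, smul_mul_assoc, ← mul_smul_comm, ← evalTrunc_const_mul]
        congr 2
        funext l
        simp only [List.map_cons, List.prod_cons, if_pos (Finset.mem_Icc.1 hn), List.length_cons,
          mul_div_assoc]
        ring_nf
      rw [Finset.sum_congr rfl h, ← Finset.sum_mul, Finset.mul_sum]
      refine Finset.sum_congr rfl fun i _ => ?_
      rw [mul_smul_comm, pow_succ', show i + (j + 1) = i + 1 + j by ring]
    · simp

theorem evalTrunc_exp_linear (M k : ℕ) (c : ℕ → ℝ) (a : ℕ → 𝔸) :
    evalTrunc M k (exp (linear M c)) a =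
      ∑ i ∈ Finset.range (k + 1), ((i ! : ℝ)⁻¹) • (∑ n ∈ Finset.Icc 1 M, c n • a n) ^ i := by
  have h := evalTrunc_exp_shift M k 0 c a
  simp only [add_zero] at h
  rw [← h]
  congr 1
  exact funext (exp_linear M c)

section Asymptotic

variable {M : ℕ} {b : ℝ → ℕ → 𝔸}

theorem hasOrder_evalTrunc (hb : ∀ n ∈ Finset.Icc 1 M, HasOrder (fun δ => b δ n) 1) (k : ℕ)
    (T : WordSeries) : HasOrder (fun δ => evalTrunc M k T (b δ)) 0 := by
  induction k generalizing T with
  | zero => exact HasOrder.const _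
  | succ k ih =>
    exact (HasOrder.const _).add (HasOrder.sum fun n hn =>
      ((hb n hn).mul (ih _)).mono (Nat.zero_le _))

theorem hasOrder_evalTrunc_succ_sub (hb : ∀ n ∈ Finset.Icc 1 M, HasOrder (fun δ => b δ n) 1)
    (k : ℕ) (T : WordSeries) :
    HasOrder (fun δ => evalTrunc M (k + 1) T (b δ) - evalTrunc M k T (b δ)) (k + 1) := by
  induction k generalizing T with
  | zero =>
    simp only [evalTrunc, add_sub_cancel_left]
    exact HasOrder.sum fun n hn => (hb n hn).mul (HasOrder.const _)
  | succ k ih =>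
    have h := HasOrder.sum fun n hn => ((hb n hn).mul (ih fun l => T (n :: l)))
    refine (h.mono (m := k + 1 + 1) (by omega)).congr_left fun δ _ => ?_
    simp only [mul_sub, Finset.sum_sub_distrib]
    rw [evalTrunc, evalTrunc, add_sub_add_left_eq_sub]

/-- Truncation is not multiplicative, but the surplus consists of words longer than `k`, and every
letter is `O(δ)`. -/
theorem hasOrder_evalTrunc_mul (hb : ∀ n ∈ Finset.Icc 1 M, HasOrder (fun δ => b δ n) 1) (k : ℕ)
    (S T : WordSeries) :
    HasOrder (fun δ => evalTrunc M k S (b δ) * evalTrunc M k T (b δ)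
      - evalTrunc M k (mul S T) (b δ)) (k + 1) := by
  induction k generalizing S T with
  | zero =>
    simp only [evalTrunc, mul_nil, mul_smul, smul_mul_assoc, _root_.one_mul, sub_self]
    exact HasOrder.zero
  | succ k ih =>
    have h1 := HasOrder.sum fun n hn => (hb n hn).mul (ih (fun l => S (n :: l)) T)
    -- The right factor is truncated at `k + 1`, the induction hypothesis at `k`; this term accounts
    -- for the gap.
    have h2 := HasOrder.sum fun n hn => (hb n hn).mul
      ((hasOrder_evalTrunc hb k fun l => S (n :: l)).mul (hasOrder_evalTrunc_succ_sub hb k T))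
    refine ((h1.mono (m := k + 1 + 1) (by omega)).add
      (h2.mono (m := k + 1 + 1) (by omega))).congr_left fun δ _ => ?_
    have h3 : evalTrunc M (k + 1) (mul S T) (b δ) = S [] • evalTrunc M (k + 1) T (b δ) +
        ∑ n ∈ Finset.Icc 1 M, b δ n * evalTrunc M k (mul (fun l => S (n :: l)) T) (b δ) := by
      simp only [evalTrunc, mul_nil, mul_cons, evalTrunc_add, evalTrunc_const_mul, mul_add,
        Finset.sum_add_distrib, smul_add, mul_smul, Finset.smul_sum, mul_smul_comm, add_assoc]
    have h4 : evalTrunc M (k + 1) S (b δ) = S [] • 1 +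
        ∑ n ∈ Finset.Icc 1 M, b δ n * evalTrunc M k (fun l => S (n :: l)) (b δ) := rfl
    rw [h3, h4, add_mul, smul_mul_assoc, _root_.one_mul, add_sub_add_left_eq_sub,
      Finset.sum_mul, ← Finset.sum_add_distrib, ← Finset.sum_sub_distrib]
    refine Finset.sum_congr rfl fun n _ => ?_
    noncomm_ring

theorem hasOrder_prod_sub_evalTrunc (hb : ∀ n ∈ Finset.Icc 1 M, HasOrder (fun δ => b δ n) 1)
    (k : ℕ) {s : ℕ} (X : Fin s → ℝ → 𝔸) (T : Fin s → WordSeries)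
    (h : ∀ i, HasOrder (fun δ => X i δ - evalTrunc M k (T i) (b δ)) (k + 1)) :
    HasOrder (fun δ => (List.ofFn fun i => X i δ).prod
      - evalTrunc M k ((List.ofFn T).foldr mul one) (b δ)) (k + 1) := by
  induction s with
  | zero => simpa [evalTrunc_one] using HasOrder.zero
  | succ s ih =>
    simp only [List.ofFn_succ, List.prod_cons, List.foldr_cons]
    have h1 := ih (fun i => X i.succ) (fun i => T i.succ) fun i => h i.succ
    set R := (List.ofFn fun i : Fin s => T i.succ).foldr mul one
    have hR := hasOrder_evalTrunc hb k R
    have hT := hasOrder_evalTrunc hb k (T 0)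
    have hP : HasOrder (fun δ => (List.ofFn fun i : Fin s => X i.succ δ).prod) 0 :=
      ((h1.mono (Nat.zero_le _)).add hR).congr_left fun δ _ => sub_add_cancel _ _
    refine ((((h 0).mul hP).mono (m := k + 1) (by omega)).add (((hT.mul h1).mono (m := k + 1)
      (by omega)).add (hasOrder_evalTrunc_mul hb k (T 0) R))).congr_left fun δ _ => ?_
    noncomm_ring

theorem hasOrder_exp_sub_evalTrunc [CompleteSpace 𝔸]
    (hb : ∀ n ∈ Finset.Icc 1 M, HasOrder (fun δ => b δ n) 1) (k : ℕ) (c : ℕ → ℝ) {Ω : ℝ → 𝔸}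
    (h : HasOrder (fun δ => Ω δ - ∑ n ∈ Finset.Icc 1 M, c n • b δ n) (k + 1)) :
    HasOrder (fun δ => NormedSpace.exp (Ω δ) - evalTrunc M k (exp (linear M c)) (b δ))
      (k + 1) := by
  have hL : HasOrder (fun δ => ∑ n ∈ Finset.Icc 1 M, c n • b δ n) 1 :=
    HasOrder.sum fun n hn => (hb n hn).smul_const _
  have hΩ : HasOrder Ω 1 :=
    ((h.mono (by omega)).add hL).congr_left fun δ _ => sub_add_cancel _ _
  have h1 := hasOrder_exp_sub_sum hΩ (k + 1)
  have h2 := HasOrder.sum (s := Finset.range (k + 1)) fun i _ =>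
    ((hΩ.mono (Nat.zero_le _)).pow_sub_pow (hL.mono (Nat.zero_le _)) h i).smul_const ((i ! : ℝ)⁻¹)
  refine (h1.add h2).congr_left fun δ _ => ?_
  simp only [smul_sub, Finset.sum_sub_distrib, evalTrunc_exp_linear]
  abel

/-- Up to terms of higher order, a product of exponentials is the value of the corresponding word
series. -/
theorem hasOrder_prod_exp_sub_evalTrunc [CompleteSpace 𝔸]
    (hb : ∀ n ∈ Finset.Icc 1 M, HasOrder (fun δ => b δ n) 1) (k : ℕ) {s : ℕ} (f : Fin s → ℕ → ℝ)
    {Ω : Fin s → ℝ → 𝔸}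
    (h : ∀ i, HasOrder (fun δ => Ω i δ - ∑ n ∈ Finset.Icc 1 M, f i n • b δ n) (k + 1)) :
    HasOrder (fun δ => (List.ofFn fun i => NormedSpace.exp (Ω i δ)).prod
      - evalTrunc M k (prodExp M f) (b δ)) (k + 1) :=
  hasOrder_prod_sub_evalTrunc hb k (fun i δ => NormedSpace.exp (Ω i δ)) _ fun i =>
    hasOrder_exp_sub_evalTrunc hb k (f i) (h i)

end Asymptotic

end WordSeries

open Polynomial (X)

/-! ### Taylor expansions of the Legendre coefficients and of their quadratures. -/

section Coefficients

variable {𝔸 : Type*} [NormedRing 𝔸] [NormedAlgebra ℝ 𝔸]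

/-- `A(t) = ∑_{j=1}^K t^{j-1} a_j + O(t^K)` as `t → 0`, with `A` continuous near `0`. -/
structure HasExpansion (A : ℝ → 𝔸) (a : ℕ → 𝔸) (K : ℕ) : Prop where
  continuousAt : ∀ᶠ t in 𝓝 (0 : ℝ), ContinuousAt A t
  isBigO : (fun t => A t - ∑ j ∈ Finset.Icc 1 K, t ^ (j - 1) • a j) =O[𝓝 0] fun t => t ^ K

theorem HasOrder.id_smul {F : ℝ → 𝔸} {k : ℕ} (hF : HasOrder F k) :
    HasOrder (fun δ => δ • F δ) (k + 1) := by
  simpa only [HasOrder, pow_succ', smul_eq_mul] using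
    IsBigO.smul (isBigO_refl (fun δ : ℝ => δ) (𝓝[>] 0)) hF

theorem _root_.AnalyticAt.exists_hasExpansion {A : ℝ → 𝔸} [CompleteSpace 𝔸]
    (hA : AnalyticAt ℝ A 0) : ∃ a : ℕ → 𝔸, ∀ K, HasExpansion A a K := by
  obtain ⟨p, hp⟩ := id hA
  refine ⟨fun j => p.coeff (j - 1), fun K => ⟨hA.eventually_continuousAt, ?_⟩⟩
  have h := hp.isBigO_sub_partialSum_pow K
  refine (h.congr_left fun t => ?_).trans (IsBigO.of_bound 1 (Eventually.of_forall fun t => by simp))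
  rw [FormalMultilinearSeries.partialSum, zero_add]
  congr 1
  refine Finset.sum_nbij' (· + 1) (· - 1) ?_ ?_ ?_ ?_ ?_ <;>
    simp only [Finset.mem_range, Finset.mem_Icc, Nat.add_sub_cancel,
      FormalMultilinearSeries.apply_eq_pow_smul_coeff, implies_true]
  all_goals omega

theorem hasExpansion_polynomial (a : ℕ → 𝔸) (K : ℕ) :
    HasExpansion (fun t : ℝ => ∑ j ∈ Finset.Icc 1 K, t ^ (j - 1) • a j) a K where
  continuousAt := Eventually.of_forall fun t => by fun_prop
  isBigO := by simpa using isBigO_zero _ _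

namespace HasExpansion

variable {A : ℝ → 𝔸} {a : ℕ → 𝔸} {K : ℕ}

theorem hasOrder (h : HasExpansion A a K) :
    HasOrder (fun t => A t - ∑ j ∈ Finset.Icc 1 K, t ^ (j - 1) • a j) K :=
  h.isBigO.mono nhdsWithin_le_nhds

theorem hasOrder_zero (h : HasExpansion A a K) : HasOrder A 0 :=
  ((h.hasOrder.mono (Nat.zero_le _)).add (HasOrder.sum fun j _ =>
    (HasOrder.pow_smul_const (k := j - 1) (a j)).mono (Nat.zero_le _))).congr_left
    fun _ _ => sub_add_cancel _ _

theorem hasOrder_quadCoeff_sub (h : HasExpansion A a K) {M : ℕ} (x w : Fin M → ℝ) (n : ℕ) :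
    HasOrder (fun δ => quadCoeff x w A n δ - ∑ j ∈ Finset.Icc 1 K,
      ((2 * (n : ℝ) - 1) * quadSum x w (legendre (n - 1) * X ^ (j - 1))) • (δ ^ j • a j))
      (K + 1) := by
  have h1 : ∀ m, HasOrder (fun δ => A (x m * δ)
      - ∑ j ∈ Finset.Icc 1 K, (x m * δ) ^ (j - 1) • a j) K := fun m => by
    have ht : Tendsto (fun δ : ℝ => x m * δ) (𝓝[>] 0) (𝓝 0) := by
      have : Tendsto (fun δ : ℝ => x m * δ) (𝓝 0) (𝓝 (x m * 0)) :=
        (continuous_const_mul (x m)).tendsto 0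
      rw [mul_zero] at this
      exact this.mono_left nhdsWithin_le_nhds
    refine (h.isBigO.comp_tendsto ht).trans ?_
    simp only [Function.comp_def, mul_pow]
    exact isBigO_const_mul_self _ _ _
  have h2 := (HasOrder.sum (s := Finset.univ) fun m _ =>
    (h1 m).smul_const (w m * (legendre (n - 1)).eval (x m))).smul_const (2 * (n : ℝ) - 1)
  refine h2.id_smul.congr_left fun δ _ => ?_
  simp only [smul_sub, Finset.sum_sub_distrib]
  rw [quadCoeff, mul_comm (2 * (n : ℝ) - 1) δ, mul_smul]
  congr 1
  simp only [Finset.smul_sum, smul_smul]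
  rw [Finset.sum_comm]
  refine Finset.sum_congr rfl fun j hj => ?_
  rw [← Finset.sum_smul]
  congr 1
  obtain ⟨i, rfl⟩ := Nat.exists_eq_add_of_le' (Finset.mem_Icc.1 hj).1
  simp only [quadSum, Nat.add_sub_cancel, Polynomial.eval_mul, Polynomial.eval_pow,
    Polynomial.eval_X, Finset.mul_sum, Finset.sum_mul]
  refine Finset.sum_congr rfl fun m _ => ?_
  ring

theorem legendreCoeff_eq (A : ℝ → 𝔸) (n : ℕ) {δ : ℝ} (hδ : δ ≠ 0) :
    legendreCoeff A n δ = ((2 * (n : ℝ) - 1) * δ) •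
      ∫ u in (0 : ℝ)..1, (legendre (n - 1)).eval u • A (u * δ) := by
  rw [legendreCoeff, mul_smul]
  congr 1
  have := intervalIntegral.integral_comp_div (a := 0) (b := δ)
    (fun u => (legendre (n - 1)).eval u • A (u * δ)) hδ
  rw [zero_div, div_self hδ] at this
  rw [← this]
  simp only [div_mul_cancel₀ _ hδ]

theorem hasOrder_integral (h : HasExpansion A a K) [CompleteSpace 𝔸] (p : Polynomial ℝ) :
    HasOrder (fun δ => (∫ u in (0 : ℝ)..1, p.eval u • A (u * δ)) - ∑ j ∈ Finset.Icc 1 K,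
      unitIntegral (p * X ^ (j - 1)) • (δ ^ (j - 1) • a j)) K := by
  obtain ⟨C, hC⟩ := h.isBigO.bound
  obtain ⟨B, hB⟩ := isCompact_Icc.exists_bound_of_continuousOn
    (s := Set.Icc (0 : ℝ) 1) p.continuous.continuousOn
  obtain ⟨η, hη, hball⟩ := Metric.eventually_nhds_iff.1 (hC.and h.continuousAt)
  refine IsBigO.of_bound (B * C) ?_
  filter_upwards [Ioo_mem_nhdsGT hη] with δ hδ
  have hmem : ∀ u ∈ Set.Icc (0 : ℝ) 1, dist (u * δ) 0 < η := fun u hu => by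
    rw [Real.dist_0_eq_abs, abs_of_nonneg (mul_nonneg hu.1 hδ.1.le)]
    exact (mul_le_of_le_one_left hδ.1.le hu.2).trans_lt hδ.2
  have hcont : ContinuousOn (fun u => p.eval u • A (u * δ)) (Set.uIcc (0 : ℝ) 1) := by
    rw [Set.uIcc_of_le zero_le_one]
    refine p.continuous.continuousOn.smul fun u hu => ?_
    have h1 : ContinuousAt (fun u => A (u * δ)) u :=
      ContinuousAt.comp (f := fun u => u * δ) (hball (hmem u hu)).2 (by fun_prop)
    exact h1.continuousWithinAt
  have hsum : ∑ j ∈ Finset.Icc 1 K, unitIntegral (p * X ^ (j - 1)) • (δ ^ (j - 1) • a j)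
      = ∫ u in (0 : ℝ)..1, p.eval u • ∑ j ∈ Finset.Icc 1 K, (u * δ) ^ (j - 1) • a j := by
    simp only [Finset.smul_sum, smul_smul]
    rw [intervalIntegral.integral_finsetSum fun j _ =>
      (Continuous.intervalIntegrable (by fun_prop) _ _)]
    refine Finset.sum_congr rfl fun j _ => ?_
    rw [intervalIntegral.integral_smul_const, unitIntegral_apply,
      ← intervalIntegral.integral_mul_const]
    congr 2
    funext u
    simp only [Polynomial.eval_mul, Polynomial.eval_pow, Polynomial.eval_X]
    ring
  rw [hsum, ← intervalIntegral.integral_sub hcont.intervalIntegrable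
    (Continuous.intervalIntegrable (by fun_prop) _ _)]
  have hbd := intervalIntegral.norm_integral_le_of_norm_le_const (a := 0) (b := 1)
    (C := B * (C * ‖δ ^ K‖)) (f := fun u => p.eval u • A (u * δ)
      - p.eval u • ∑ j ∈ Finset.Icc 1 K, (u * δ) ^ (j - 1) • a j) ?_
  · simpa [mul_assoc] using hbd
  · intro u hu
    rw [Set.uIoc_of_le zero_le_one] at hu
    have hu' : u ∈ Set.Icc (0 : ℝ) 1 := ⟨hu.1.le, hu.2⟩
    rw [← smul_sub, norm_smul]
    have h1 := (hball (hmem u hu')).1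
    have h2 : C * ‖(u * δ) ^ K‖ ≤ C * ‖δ ^ K‖ := by
      have hpos : 0 < ‖(u * δ) ^ K‖ := by
        rw [norm_pos_iff]
        exact pow_ne_zero _ (mul_pos hu.1 hδ.1).ne'
      have hC0 : 0 ≤ C := nonneg_of_mul_nonneg_left ((norm_nonneg _).trans h1) hpos
      refine mul_le_mul_of_nonneg_left ?_ hC0
      rw [norm_pow, norm_pow]
      refine pow_le_pow_left₀ (norm_nonneg _) ?_ _
      rw [Real.norm_of_nonneg (mul_nonneg hu'.1 hδ.1.le), Real.norm_of_nonneg hδ.1.le]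
      exact mul_le_of_le_one_left hδ.1.le hu.2
    exact mul_le_mul (hB u hu') (h1.trans h2) (norm_nonneg _) ((norm_nonneg _).trans (hB u hu'))

theorem hasOrder_legendreCoeff_sub (h : HasExpansion A a K) [CompleteSpace 𝔸] (n : ℕ) :
    HasOrder (fun δ => legendreCoeff A n δ - ∑ j ∈ Finset.Icc 1 K,
      ((2 * (n : ℝ) - 1) * unitIntegral (legendre (n - 1) * X ^ (j - 1))) • (δ ^ j • a j))
      (K + 1) := by
  have h2 := (h.hasOrder_integral (legendre (n - 1))).smul_const (2 * (n : ℝ) - 1)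
  refine h2.id_smul.congr_left fun δ hδ => ?_
  rw [legendreCoeff_eq A n hδ.ne', smul_sub, smul_sub, smul_smul, mul_comm δ]
  congr 1
  simp only [Finset.smul_sum, smul_smul]
  refine Finset.sum_congr rfl fun j hj => ?_
  congr 1
  obtain ⟨i, rfl⟩ := Nat.exists_eq_add_of_le' (Finset.mem_Icc.1 hj).1
  rw [Nat.add_sub_cancel]
  ring

/-- Orthogonality of `P_{n-1}` to the powers below `n - 1` removes the Taylor terms `j < n`. -/
theorem hasOrder_legendreCoeff [CompleteSpace 𝔸] (h : ∀ K, HasExpansion A a K) (n : ℕ) :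
    HasOrder (legendreCoeff A n) n := by
  have h1 := ((h n).hasOrder_legendreCoeff_sub n).mono (Nat.le_succ n)
  have h2 : HasOrder (fun δ => ∑ j ∈ Finset.Icc 1 n, ((2 * (n : ℝ) - 1) *
      unitIntegral (legendre (n - 1) * X ^ (j - 1))) • (δ ^ j • a j)) n := by
    refine HasOrder.sum fun j hj => ?_
    have hj' := Finset.mem_Icc.1 hj
    rcases hj'.2.eq_or_lt with rfl | hlt
    · exact (HasOrder.pow_smul_const _).smul_const _
    · rw [unitIntegral_legendre_mul_X_pow (by omega)]
      simpa using HasOrder.zero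
  exact (h1.add h2).congr_left fun _ _ => sub_add_cancel _ _

theorem hasOrder_quadCoeff_sub_legendreCoeff [CompleteSpace 𝔸] (h : ∀ K, HasExpansion A a K)
    {M : ℕ} {x w : Fin M → ℝ} (hxw : IsGaussLegendre M x w) {n : ℕ} (hn : 1 ≤ n) (hnM : n ≤ M) :
    HasOrder (fun δ => quadCoeff x w A n δ - legendreCoeff A n δ) (2 * M + 2 - n) := by
  have h1 := ((h (2 * M + 1 - n)).hasOrder_quadCoeff_sub x w n).sub
    ((h (2 * M + 1 - n)).hasOrder_legendreCoeff_sub n)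
  rw [show 2 * M + 1 - n + 1 = 2 * M + 2 - n by omega] at h1
  refine h1.congr_left fun δ _ => ?_
  rw [sub_sub_sub_comm, ← Finset.sum_sub_distrib, Finset.sum_eq_zero, sub_zero]
  intro j hj
  have hj' := Finset.mem_Icc.1 hj
  -- The integrand `P_{n-1} X^(j-1)` has degree `n + j - 2`, which is below `2M` exactly for `j ≤ 2M
  -- + 1 - n`.
  rw [hxw.quadSum_eq, sub_self]
  refine (Polynomial.natDegree_mul_le).trans_lt ?_
  rw [natDegree_legendre, Polynomial.natDegree_X_pow]
  omega

end HasExpansion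

end Coefficients

/-! ### Dyson expansion of the propagator. -/

section Propagator

variable {𝔸 : Type*} [NormedRing 𝔸] [NormedAlgebra ℝ 𝔸]

/-- The coefficients `∏_i (n_i + ⋯ + n_m)⁻¹` of the propagator of `∑_n t^{n-1} a_n` at time `1`. -/
def dyson : WordSeries
  | [] => 1
  | n :: v => dyson v / ((n + v.sum : ℕ) : ℝ)

/-- The bound on `f'` is available only for `t > 0`, so the mean value inequality is applied between
`y > 0` and `δ`, and then `y → 0`. -/
theorem hasOrder_of_hasDerivAt {E : Type*} [NormedAddCommGroup E] [NormedSpace ℝ E] {f f' : ℝ → E}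
    {k : ℕ} (hf : ∀ᶠ t in 𝓝 (0 : ℝ), HasDerivAt f (f' t) t) (h0 : f 0 = 0) (h : HasOrder f' k) :
    HasOrder f (k + 1) := by
  obtain ⟨C, hC⟩ := IsBigO.bound h
  obtain ⟨η, hη, hball⟩ := Metric.eventually_nhds_iff.1 hf
  obtain ⟨ε, hε, hsub⟩ := mem_nhdsGT_iff_exists_Ioo_subset.1 hC
  refine IsBigO.of_bound C ?_
  filter_upwards [Ioo_mem_nhdsGT (lt_min hη hε)] with δ hδ
  have hδη := hδ.2.trans_le (min_le_left _ _)
  have hδε := hδ.2.trans_le (min_le_right _ _)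
  have hd : ∀ t ∈ Set.Icc 0 δ, HasDerivAt f (f' t) t := fun t ht => hball (by
    rw [Real.dist_0_eq_abs, abs_of_nonneg ht.1]
    exact ht.2.trans_lt hδη)
  have hC0 : 0 ≤ C := by
    have h1 := (norm_nonneg _).trans (hsub ⟨hδ.1, hδε⟩)
    exact nonneg_of_mul_nonneg_left h1 (norm_pos_iff.2 (pow_ne_zero _ hδ.1.ne'))
  have h1 : ∀ y ∈ Set.Ioc 0 δ, ‖f δ - f y‖ ≤ C * δ ^ k * ‖δ - y‖ := fun y hy => by
    refine (convex_Ioc 0 δ).norm_image_sub_le_of_norm_hasDerivWithin_le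
      (fun t ht => (hd t ⟨ht.1.le, ht.2⟩).hasDerivWithinAt) (fun t ht => ?_) hy ⟨hδ.1, le_rfl⟩
    refine (hsub ⟨ht.1, ht.2.trans_lt hδε⟩).trans (mul_le_mul_of_nonneg_left ?_ hC0)
    rw [norm_pow, Real.norm_of_nonneg ht.1.le]
    exact pow_le_pow_left₀ ht.1.le ht.2 k
  have hc : ContinuousAt f 0 := (hd 0 ⟨le_rfl, hδ.1.le⟩).continuousAt
  have h2 : Tendsto (fun y => ‖f δ - f y‖) (𝓝[>] 0) (𝓝 ‖f δ - f 0‖) :=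
    (tendsto_const_nhds.sub (hc.tendsto.mono_left nhdsWithin_le_nhds)).norm
  have h3 : Tendsto (fun y : ℝ => C * δ ^ k * ‖δ - y‖) (𝓝[>] 0) (𝓝 (C * δ ^ k * ‖δ - 0‖)) :=
    (Continuous.tendsto (by fun_prop) 0).mono_left nhdsWithin_le_nhds
  have h4 := le_of_tendsto_of_tendsto h2 h3 (by
    filter_upwards [Ioc_mem_nhdsGT hδ.1] with y hy using h1 y hy)
  rw [h0, sub_zero, sub_zero, Real.norm_of_nonneg hδ.1.le] at h4
  rwa [norm_pow, Real.norm_of_nonneg hδ.1.le, pow_succ, ← mul_assoc]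

theorem evalTrunc_zero_letters (M k : ℕ) (T : WordSeries) {b : ℕ → 𝔸}
    (hb : ∀ n ∈ Finset.Icc 1 M, b n = 0) : WordSeries.evalTrunc M k T b = T [] • 1 := by
  cases k with
  | zero => rfl
  | succ k =>
    rw [WordSeries.evalTrunc, Finset.sum_eq_zero, add_zero]
    intro n hn
    rw [hb n hn, zero_mul]

/-- A word `v` multiplied by `t^n` is homogeneous of degree `n + v.sum` in `t`, so dividing by this
number is integration. Stripping a letter `j` turns `n` into `n + j`. -/
theorem hasDerivAt_evalTrunc_div (M k : ℕ) (T : WordSeries) (a : ℕ → 𝔸) {n : ℕ} (hn : 1 ≤ n)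
    (t : ℝ) :
    HasDerivAt (fun t : ℝ => t ^ n • WordSeries.evalTrunc M k
        (fun v => T v / ((n + v.sum : ℕ) : ℝ)) fun j => t ^ j • a j)
      (t ^ (n - 1) • WordSeries.evalTrunc M k T fun j => t ^ j • a j) t := by
  have hbase : ∀ {n : ℕ} (hn : 1 ≤ n) (T : WordSeries), HasDerivAt (fun t : ℝ => t ^ n • ((T [] / (n : ℝ)) • (1 : 𝔸)))
      (t ^ (n - 1) • (T [] • (1 : 𝔸))) t := fun {n} hn T => by
    have hn0 : (n : ℝ) ≠ 0 := by positivity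
    refine ((hasDerivAt_pow n t).smul_const ((T [] / (n : ℝ)) • (1 : 𝔸))).congr_deriv ?_
    rw [smul_smul, smul_smul]
    congr 1
    field_simp
  induction k generalizing T n with
  | zero => simpa [WordSeries.evalTrunc] using hbase hn T
  | succ k ih =>
    have h1 := (hbase hn T).add (HasDerivAt.fun_sum (u := Finset.Icc 1 M) fun j hj =>
      (ih (fun v => T (j :: v)) (n := n + j) (by omega)).const_mul (a j))
    refine (h1.congr_deriv ?_).congr_of_eventuallyEq (Eventually.of_forall fun t => ?_)
    · rw [WordSeries.evalTrunc, smul_add, Finset.smul_sum]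
      congr 1
      refine Finset.sum_congr rfl fun j hj => ?_
      rw [smul_mul_assoc, mul_smul_comm, smul_smul, ← pow_add, Nat.sub_add_comm hn]
    · simp only [WordSeries.evalTrunc, smul_add, Finset.smul_sum, List.sum_nil, add_zero,
        List.sum_cons, Pi.add_apply]
      congr 1
      refine Finset.sum_congr rfl fun j hj => ?_
      rw [smul_mul_assoc, mul_smul_comm, smul_smul, ← pow_add]
      simp only [add_assoc]

theorem hasDerivAt_evalTrunc_dyson (M k : ℕ) (a : ℕ → 𝔸) (t : ℝ) :
    HasDerivAt (fun t : ℝ => WordSeries.evalTrunc M (k + 1) dyson fun j => t ^ j • a j)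
      ((∑ j ∈ Finset.Icc 1 M, t ^ (j - 1) • a j) *
        WordSeries.evalTrunc M k dyson fun j => t ^ j • a j) t := by
  have h1 := (HasDerivAt.fun_sum (u := Finset.Icc 1 M) fun j hj =>
    (hasDerivAt_evalTrunc_div M k dyson a (Finset.mem_Icc.1 hj).1 t).const_mul (a j)).const_add
    (1 : 𝔸)
  refine (h1.congr_deriv ?_).congr_of_eventuallyEq (Eventually.of_forall fun t => ?_)
  · rw [Finset.sum_mul]
    exact Finset.sum_congr rfl fun j _ => by rw [smul_mul_assoc, mul_smul_comm]
  · simp only [WordSeries.evalTrunc, dyson, one_smul]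
    congr 1
    exact Finset.sum_congr rfl fun j _ => by rw [smul_mul_assoc, mul_smul_comm]

/-- Picard iteration: the truncation at length `k + 1` integrates the Taylor polynomial of `A` times
the truncation at length `k`, so each length gains one order. -/
theorem HasExpansion.hasOrder_propagator_sub {A U : ℝ → 𝔸} {a : ℕ → 𝔸} {N : ℕ}
    (h : HasExpansion A a N) (hU : IsPropagator A U) :
    HasOrder (fun δ => U δ - WordSeries.evalTrunc N N dyson fun j => δ ^ j • a j) (N + 1) := by
  suffices ∀ k ≤ N, HasOrder (fun δ => U δ -
      WordSeries.evalTrunc N k dyson fun j => δ ^ j • a j) (k + 1) from this N le_rfl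
  intro k
  induction k with
  | zero =>
    intro _
    have h1 := (hU.2.self_of_nhds.isBigO_sub).mono (nhdsWithin_le_nhds (s := Set.Ioi 0))
    simpa [HasOrder, WordSeries.evalTrunc, dyson, hU.1] using h1
  | succ k ih =>
    intro hk
    have hb : ∀ n ∈ Finset.Icc 1 N, HasOrder (fun δ : ℝ => δ ^ n • a n) 1 := fun n hn =>
      (HasOrder.pow_smul_const _).mono (Finset.mem_Icc.1 hn).1
    refine hasOrder_of_hasDerivAt (f' := fun t => A t * U t -
      (∑ j ∈ Finset.Icc 1 N, t ^ (j - 1) • a j) *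
        WordSeries.evalTrunc N k dyson fun j => t ^ j • a j) ?_ ?_ ?_
    · filter_upwards [hU.2] with t ht
      exact ht.sub (hasDerivAt_evalTrunc_dyson N k a t)
    · rw [hU.1, evalTrunc_zero_letters, dyson, one_smul, sub_self]
      intro n hn
      rw [zero_pow (by have := (Finset.mem_Icc.1 hn).1; omega), zero_smul]
    · have h1 := h.hasOrder_zero.mul (ih (by omega))
      have h2 := h.hasOrder.mul (WordSeries.hasOrder_evalTrunc hb k dyson)
      refine ((h1.mono (m := k + 1) (by omega)).add
        (h2.mono (m := k + 1) (by omega))).congr_left fun t _ => ?_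
      noncomm_ring

/-- The coefficients of the exponents of a commutator-free product with respect to the Taylor
coefficients. -/
def taylorWeight (M : ℕ) {s : ℕ} (f : Fin s → ℕ → ℝ) (i : Fin s) (j : ℕ) : ℝ :=
  ∑ n ∈ Finset.Icc 1 M,
    f i n * ((2 * (n : ℝ) - 1) * unitIntegral (legendre (n - 1) * X ^ (j - 1)))

theorem HasExpansion.hasOrder_cfet_sub [CompleteSpace 𝔸] {A : ℝ → 𝔸} {a : ℕ → 𝔸} {N : ℕ}
    (h : HasExpansion A a N) (M : ℕ) {s : ℕ} (f : Fin s → ℕ → ℝ) :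
    HasOrder (fun δ => cfet M f A δ - WordSeries.evalTrunc N N
      (WordSeries.prodExp N (taylorWeight M f)) fun j => δ ^ j • a j) (N + 1) := by
  refine WordSeries.hasOrder_prod_exp_sub_evalTrunc (fun n hn =>
    (HasOrder.pow_smul_const _).mono (Finset.mem_Icc.1 hn).1) N (taylorWeight M f) fun i => ?_
  refine (HasOrder.sum (s := Finset.Icc 1 M) fun n _ =>
    (h.hasOrder_legendreCoeff_sub n).smul_const (f i n)).congr_left fun δ _ => ?_
  simp only [smul_sub, Finset.sum_sub_distrib]
  congr 1
  simp only [Finset.smul_sum]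
  rw [Finset.sum_comm]
  refine Finset.sum_congr rfl fun j _ => ?_
  rw [taylorWeight, Finset.sum_smul]
  exact Finset.sum_congr rfl fun n _ => smul_smul _ _ _

end Propagator

/-! ### Vanishing sets of word series and linear substitution of letters. -/

namespace WordSeries

section Vanishing

variable {V : List ℕ → Prop} {S T : WordSeries}

/-- If every cut of a word in `V` leaves a piece in `V`, the series vanishing on `V` are closed
under products. This carries the index condition through the logarithm. -/
theorem mul_eq_zero_of (hV : ∀ l j, V l → V (l.take j) ∨ V (l.drop j)) (hS : ∀ l, V l → S l = 0)
    (hT : ∀ l, V l → T l = 0) (l : List ℕ) (hl : V l) : mul S T l = 0 :=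
  Finset.sum_eq_zero fun j _ => by
    rcases hV l j hl with h | h
    · rw [hS _ h, zero_mul]
    · rw [hT _ h, mul_zero]

theorem one_eq_zero_of (hV : ¬ V []) (l : List ℕ) (hl : V l) : one l = 0 :=
  if_neg fun (h : l = []) => hV (h ▸ hl)

theorem pow_eq_zero_of (hV : ∀ l j, V l → V (l.take j) ∨ V (l.drop j)) (hV0 : ¬ V [])
    (hS : ∀ l, V l → S l = 0) (k : ℕ) : ∀ l, V l → pow S k l = 0 := by
  induction k with
  | zero => exact one_eq_zero_of hV0
  | succ k ih => exact mul_eq_zero_of hV hS ih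

theorem log_eq_zero_of (hV : ∀ l j, V l → V (l.take j) ∨ V (l.drop j)) (hV0 : ¬ V [])
    (hS : ∀ l, V l → S l = 0) (l : List ℕ) (hl : V l) : log S l = 0 :=
  Finset.sum_eq_zero fun k _ => by
    rw [pow_eq_zero_of hV hV0 (fun v hv => ?_) k l hl, mul_zero]
    rw [hS v hv, one_eq_zero_of hV0 v hv, sub_zero]

theorem prodExp_eq_zero_of_not_mem {M s : ℕ} (f : Fin s → ℕ → ℝ) (l : List ℕ)
    (hl : ∃ n ∈ l, ¬ (1 ≤ n ∧ n ≤ M)) : prodExp M f l = 0 := by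
  have hV : ∀ (l : List ℕ) (j : ℕ), (∃ n ∈ l, ¬ (1 ≤ n ∧ n ≤ M)) →
      (∃ n ∈ l.take j, ¬ (1 ≤ n ∧ n ≤ M)) ∨ ∃ n ∈ l.drop j, ¬ (1 ≤ n ∧ n ≤ M) := by
    rintro l j ⟨n, hn, h⟩
    rw [← List.take_append_drop j l, List.mem_append] at hn
    exact hn.imp (fun hn => ⟨n, hn, h⟩) fun hn => ⟨n, hn, h⟩
  revert l
  unfold prodExp
  induction s with
  | zero => exact one_eq_zero_of (by simp)
  | succ s ih =>
    simp only [List.ofFn_succ, List.foldr_cons]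
    refine mul_eq_zero_of hV ?_ (ih fun i => f i.succ)
    rintro l ⟨n, hn, h⟩
    rw [exp_linear, List.prod_eq_zero, zero_div]
    exact List.mem_map.2 ⟨n, hn, if_neg h⟩

end Vanishing

section Substitution

variable {V W : Type*} [AddCommGroup V] [Module ℝ V] [AddCommGroup W] [Module ℝ W]

/-- The coefficient of the word `l` after the linear substitution `a_j ↦ ∑_n p_{n,j} a_n`,
`1 ≤ j ≤ N`, in a series with coefficients `T`. -/
def subst (N : ℕ) (p : ℕ → ℕ → ℝ) : List ℕ → (List ℕ → V) → V
  | [], T => T []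
  | n :: l, T => ∑ j ∈ Finset.Icc 1 N, p n j • subst N p l fun v => T (j :: v)

variable (N : ℕ) (p : ℕ → ℕ → ℝ)

/-- Module-valued coefficients allow series of polynomials; evaluation, differentiation and
multiplication by a polynomial then commute with the substitution. -/
theorem subst_map (L : V →ₗ[ℝ] W) (l : List ℕ) (T : List ℕ → V) :
    subst N p l (fun v => L (T v)) = L (subst N p l T) := by
  induction l generalizing T with
  | nil => rfl
  | cons n l ih => simp only [subst, ih, map_sum, map_smul]

theorem subst_add (l : List ℕ) (S T : List ℕ → V) :
    subst N p l (fun v => S v + T v) = subst N p l S + subst N p l T := by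
  induction l generalizing S T with
  | nil => rfl
  | cons n l ih => simp only [subst, ih, smul_add, Finset.sum_add_distrib]

theorem subst_const_mul (l : List ℕ) (c : ℝ) (T : List ℕ → ℝ) :
    subst N p l (fun v => c * T v) = c * subst N p l T :=
  subst_map N p (LinearMap.mulLeft ℝ c) l T

theorem subst_one (l : List ℕ) : subst N p l one = one l := by
  cases l with
  | nil => rfl
  | cons n l =>
    have h : ∀ j : ℕ, (fun v => one (j :: v)) = fun v : List ℕ => 0 * one v := fun j => by
      funext v
      simp [one]
    simp only [subst, h, subst_const_mul]
    simp [one]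

theorem subst_mul (l : List ℕ) (S T : WordSeries) :
    subst N p l (mul S T) = mul (fun v => subst N p v S) (fun v => subst N p v T) l := by
  induction l generalizing S T with
  | nil => simp [subst, mul_nil]
  | cons n l ih =>
    have h : (fun v => ∑ j ∈ Finset.Icc 1 N, p n j • subst N p v fun v => S (j :: v)) =
        fun v => subst N p (n :: v) S := rfl
    have h2 : ∀ U : WordSeries, mul (fun v => ∑ j ∈ Finset.Icc 1 N,
        p n j • subst N p v fun v => S (j :: v)) U l = ∑ j ∈ Finset.Icc 1 N,
          p n j * mul (fun v => subst N p v fun v => S (j :: v)) U l := fun U => by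
      simp only [mul, Finset.sum_mul, Finset.mul_sum, smul_eq_mul, mul_assoc]
      rw [Finset.sum_comm]
    rw [mul_cons, ← h, h2]
    simp only [subst, mul_cons, subst_add, subst_const_mul, ih, smul_eq_mul, mul_add,
      Finset.sum_add_distrib, Finset.mul_sum]
    congr 1
    exact Finset.sum_congr rfl fun j _ => by ring

theorem subst_exp_shift (c : ℕ → ℝ) (j : ℕ) (l : List ℕ) :
    subst N p l (fun v => (v.map c).prod / ((v.length + j)! : ℝ)) =
      (l.map fun n => ∑ i ∈ Finset.Icc 1 N, p n i * c i).prod / ((l.length + j)! : ℝ) := by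
  induction l generalizing j with
  | nil => rfl
  | cons n l ih =>
    have h : ∀ i : ℕ, (fun v : List ℕ => ((i :: v).map c).prod / (((i :: v).length + j)! : ℝ)) =
        fun v => c i * ((v.map c).prod / ((v.length + (j + 1))! : ℝ)) := fun i => by
      funext v
      simp only [List.map_cons, List.prod_cons, List.length_cons, mul_div_assoc]
      ring_nf
    simp only [subst, h, subst_const_mul, ih]
    simp only [List.map_cons, List.prod_cons, List.length_cons, smul_eq_mul, ← mul_assoc,
      mul_div_assoc]
    rw [← Finset.sum_mul, show l.length + (j + 1) = l.length + 1 + j by ring]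

theorem subst_exp_linear {M : ℕ} {c d : ℕ → ℝ}
    (h : ∀ n, 1 ≤ n → n ≤ M → ∑ j ∈ Finset.Icc 1 N, p n j * c j = d n) {l : List ℕ}
    (hl : ∀ n ∈ l, 1 ≤ n ∧ n ≤ M) : subst N p l (exp (linear N c)) = exp (linear M d) l := by
  have h1 := subst_exp_shift N p (fun n => if 1 ≤ n ∧ n ≤ N then c n else 0) 0 l
  simp only [add_zero, ← exp_linear] at h1
  refine h1.trans ?_
  rw [exp_linear]
  congr 2
  refine List.map_congr_left fun n hn => ?_
  rw [if_pos (hl n hn), ← h n (hl n hn).1 (hl n hn).2]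
  exact Finset.sum_congr rfl fun j hj => by rw [if_pos (Finset.mem_Icc.1 hj)]

theorem subst_prodExp {M s : ℕ} {c d : Fin s → ℕ → ℝ}
    (h : ∀ i n, 1 ≤ n → n ≤ M → ∑ j ∈ Finset.Icc 1 N, p n j * c i j = d i n) {l : List ℕ}
    (hl : ∀ n ∈ l, 1 ≤ n ∧ n ≤ M) : subst N p l (prodExp N c) = prodExp M d l := by
  unfold prodExp
  induction s generalizing l with
  | zero => exact subst_one N p l
  | succ s ih =>
    simp only [List.ofFn_succ, List.foldr_cons]
    rw [subst_mul]
    refine Finset.sum_congr rfl fun j _ => ?_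
    beta_reduce
    rw [subst_exp_linear N p (h 0) fun n hn => hl n (List.mem_of_mem_take hn),
      ih (fun i => h i.succ) fun n hn => hl n (List.mem_of_mem_drop hn)]

/-- A triangular substitution draws the coefficient of `l` only from words of weight at most
`l.sum`, the range where order conditions are available. -/
theorem subst_congr {l : List ℕ} (hp : ∀ n ∈ l, ∀ j, n < j → p n j = 0) {S T : List ℕ → V}
    (h : ∀ v : List ℕ, (∀ n ∈ v, 1 ≤ n ∧ n ≤ N) → v.sum ≤ l.sum → S v = T v) :
    subst N p l S = subst N p l T := by
  induction l generalizing S T with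
  | nil => exact h [] (by simp) le_rfl
  | cons n l ih =>
    refine Finset.sum_congr rfl fun j hj => ?_
    rcases lt_or_ge n j with hn | hn
    · rw [hp n List.mem_cons_self j hn, zero_smul, zero_smul]
    · congr 1
      refine ih (fun m hm => hp m (List.mem_cons_of_mem _ hm)) fun v hv hs => h _ ?_ ?_
      · simpa using ⟨Finset.mem_Icc.1 hj, hv⟩
      · simp only [List.sum_cons]
        omega

end Substitution

end WordSeries

/-! ### Iterated integrals of Legendre polynomials. -/

section Iterated

open Polynomial WordSeries

/-- The coefficients of the shifted Legendre polynomials, `P_{n-1} = ∑_j p_{n,j} X^{j-1}`. -/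
def legendreMatrix (n j : ℕ) : ℝ := (legendre (n - 1)).coeff (j - 1)

theorem sum_legendreMatrix {N n : ℕ} (hn : 1 ≤ n) (hnN : n ≤ N) :
    ∑ j ∈ Finset.Icc 1 N, C (legendreMatrix n j) * X ^ (j - 1) = legendre (n - 1) := by
  rw [as_sum_range_C_mul_X_pow' (legendre (n - 1)) (n := N) (by rw [natDegree_legendre]; omega)]
  refine Finset.sum_nbij' (· - 1) (· + 1) ?_ ?_ ?_ ?_ ?_ <;>
    simp only [Finset.mem_range, Finset.mem_Icc, Nat.add_sub_cancel, legendreMatrix, implies_true]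
  · omega
  · omega
  · omega

/-- The sum over `j` reassembles `P_{n-1}` from its coefficients, and the orthogonality relations
leave only `f i n`. Thus the substitution inverts the passage from `f` to `taylorWeight`. -/
theorem sum_legendreMatrix_mul_taylorWeight {N M s : ℕ} (hMN : M ≤ N) (f : Fin s → ℕ → ℝ)
    (i : Fin s) (n : ℕ) (hn : 1 ≤ n) (hnM : n ≤ M) :
    ∑ j ∈ Finset.Icc 1 N, legendreMatrix n j * taylorWeight M f i j = f i n := by
  have h : ∀ m, ∑ j ∈ Finset.Icc 1 N, legendreMatrix n j *
      unitIntegral (legendre (m - 1) * X ^ (j - 1)) =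
      unitIntegral (legendre (m - 1) * legendre (n - 1)) := fun m => by
    rw [← sum_legendreMatrix hn (hnM.trans hMN), Finset.mul_sum, map_sum]
    exact Finset.sum_congr rfl fun j _ => by rw [mul_left_comm, unitIntegral_C_mul]
  simp only [taylorWeight, Finset.mul_sum]
  rw [Finset.sum_comm]
  have h2 : ∀ m, ∑ j ∈ Finset.Icc 1 N, legendreMatrix n j * (f i m * ((2 * (m : ℝ) - 1) *
      unitIntegral (legendre (m - 1) * X ^ (j - 1)))) = f i m * ((2 * (m : ℝ) - 1) *
      unitIntegral (legendre (m - 1) * legendre (n - 1))) := fun m => by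
    rw [← h, Finset.mul_sum, Finset.mul_sum]
    exact Finset.sum_congr rfl fun j _ => by ring
  simp only [h2]
  rw [Finset.sum_eq_single_of_mem n (Finset.mem_Icc.2 ⟨hn, hnM⟩)]
  · obtain ⟨k, rfl⟩ := Nat.exists_eq_add_of_le' hn
    have h3 := unitIntegral_legendre_sq k
    rw [Nat.add_sub_cancel]
    push_cast
    rw [show 2 * ((k : ℝ) + 1) - 1 = 2 * k + 1 by ring, h3, mul_one]
  · intro m hm hmn
    have := (Finset.mem_Icc.1 hm).1
    rw [unitIntegral_legendre_mul_legendre (by omega), mul_zero, mul_zero]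

/-- The iterated integrals `t ↦ ∫_0^t P_{n_1-1}(t_1) ∫_0^{t_1} P_{n_2-1}(t_2) ⋯` of the shifted
Legendre polynomials with indices `n_i ≤ N`. -/
def legendreIterated (N : ℕ) (l : List ℕ) : ℝ[X] :=
  subst N legendreMatrix l fun v => C (dyson v) * X ^ v.sum

theorem eval_one_legendreIterated (N : ℕ) (l : List ℕ) :
    (legendreIterated N l).eval 1 = subst N legendreMatrix l dyson := by
  rw [legendreIterated, ← leval_apply, ← subst_map]
  simp

theorem legendreIterated_nil (N : ℕ) : legendreIterated N [] = 1 := by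
  simp [legendreIterated, subst, dyson]

theorem eval_zero_legendreIterated_cons (N n : ℕ) (l : List ℕ) :
    (legendreIterated N (n :: l)).eval 0 = 0 := by
  rw [legendreIterated, subst, eval_finsetSum]
  refine Finset.sum_eq_zero fun j hj => ?_
  have hj' := (Finset.mem_Icc.1 hj).1
  rw [eval_smul, ← leval_apply, ← subst_map]
  have h : (fun v : List ℕ => leval (0 : ℝ) (C (dyson (j :: v)) * X ^ (j :: v).sum)) =
      fun v => 0 * dyson v := by
    funext v
    simp
    omega
  rw [h, subst_const_mul, zero_mul, smul_zero]

theorem derivative_legendreIterated_cons {N n : ℕ} (hn : 1 ≤ n) (hnN : n ≤ N) (l : List ℕ) :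
    derivative (legendreIterated N (n :: l)) = legendre (n - 1) * legendreIterated N l := by
  rw [← sum_legendreMatrix hn hnN, legendreIterated, subst, derivative_sum, Finset.sum_mul]
  refine Finset.sum_congr rfl fun j hj => ?_
  have hj' := (Finset.mem_Icc.1 hj).1
  rw [derivative_smul, ← subst_map, smul_eq_C_mul, mul_assoc, legendreIterated]
  congr 1
  rw [← LinearMap.mulLeft_apply (R := ℝ), ← subst_map]
  congr 1
  funext v
  have h0 : ((j + v.sum : ℕ) : ℝ) ≠ 0 := by
    have : 0 < j + v.sum := by omega
    positivity
  rw [derivative_C_mul_X_pow, LinearMap.mulLeft_apply, List.sum_cons, dyson, mul_left_comm,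
    ← pow_add, Nat.sub_add_comm hj', div_mul_cancel₀ _ h0]

theorem natDegree_le_natDegree_derivative_add_one (q : ℝ[X]) :
    q.natDegree ≤ (derivative q).natDegree + 1 := by
  rcases Nat.eq_zero_or_pos q.natDegree with h | h
  · omega
  · have := natDegree_eq_of_degree_eq_some (degree_derivative h.ne')
    omega

theorem natDegree_legendreIterated_le {N : ℕ} {l : List ℕ} (hl : ∀ n ∈ l, 1 ≤ n ∧ n ≤ N) :
    (legendreIterated N l).natDegree ≤ l.sum := by
  induction l with
  | nil => simp [legendreIterated_nil]
  | cons n l ih =>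
    have hn := hl n List.mem_cons_self
    have h1 := natDegree_le_natDegree_derivative_add_one (legendreIterated N (n :: l))
    rw [derivative_legendreIterated_cons hn.1 hn.2] at h1
    have h2 := natDegree_mul_le (p := legendre (n - 1)) (q := legendreIterated N l)
    rw [natDegree_legendre] at h2
    have h3 := ih fun m hm => hl m (List.mem_cons_of_mem _ hm)
    rw [List.sum_cons]
    omega

theorem exists_antiderivative (R : ℝ[X]) : ∃ Q : ℝ[X], derivative Q = R ∧ Q.eval 1 = 0 ∧
    Q.natDegree ≤ R.natDegree + 1 := by
  obtain ⟨Q, hQ⟩ : ∃ Q : ℝ[X], derivative Q = R := by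
    refine ⟨∑ i ∈ Finset.range (R.natDegree + 1), C (R.coeff i / (i + 1)) * X ^ (i + 1), ?_⟩
    rw [derivative_sum]
    conv_rhs => rw [R.as_sum_range_C_mul_X_pow]
    refine Finset.sum_congr rfl fun i _ => ?_
    have : ((i : ℝ) + 1) ≠ 0 := by positivity
    rw [derivative_C_mul_X_pow, Nat.add_sub_cancel]
    push_cast
    rw [div_mul_cancel₀ _ this]
  refine ⟨Q - C (Q.eval 1), ?_, by simp, ?_⟩
  · rw [derivative_sub, derivative_C, sub_zero, hQ]
  · rw [natDegree_sub_C, ← hQ]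
    exact natDegree_le_natDegree_derivative_add_one Q

/-- Integration by parts with an antiderivative of `R` that is zero at `1`; the iterated integral is
zero at `0`, so no boundary term survives. -/
theorem exists_unitIntegral_legendreIterated_cons {N : ℕ} (R : ℝ[X]) :
    ∃ Q : ℝ[X], Q.natDegree ≤ R.natDegree + 1 ∧ ∀ n v, 1 ≤ n → n ≤ N →
      unitIntegral (R * legendreIterated N (n :: v)) =
        unitIntegral (Q * (legendre (n - 1) * legendreIterated N v)) := by
  obtain ⟨Q, hQ, hQ1, hQd⟩ := exists_antiderivative R
  refine ⟨-Q, by rwa [natDegree_neg], fun n v hn hnN => ?_⟩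
  have h := unitIntegral_derivative (Q * legendreIterated N (n :: v))
  rw [derivative_mul, hQ, derivative_legendreIterated_cons hn hnN, map_add, eval_mul, eval_mul,
    hQ1, eval_zero_legendreIterated_cons] at h
  rw [neg_mul, map_neg]
  linarith

theorem exists_unitIntegral_legendreIterated_append {N : ℕ} {u : List ℕ}
    (hu : ∀ n ∈ u, 1 ≤ n ∧ n ≤ N) (R : ℝ[X]) :
    ∃ Q : ℝ[X], Q.natDegree ≤ R.natDegree + 1 + u.sum ∧ ∀ n v, 1 ≤ n → n ≤ N →
      unitIntegral (R * legendreIterated N (u ++ n :: v)) =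
        unitIntegral (Q * (legendre (n - 1) * legendreIterated N v)) := by
  induction u generalizing R with
  | nil => simpa using exists_unitIntegral_legendreIterated_cons R
  | cons m u ih =>
    have hm := hu m List.mem_cons_self
    obtain ⟨Q, hQd, hQ⟩ := exists_unitIntegral_legendreIterated_cons (N := N) R
    obtain ⟨Q', hQd', hQ'⟩ := ih (fun n hn => hu n (List.mem_cons_of_mem _ hn))
      (Q * legendre (m - 1))
    refine ⟨Q', ?_, fun n v hn hnN => ?_⟩
    · have h2 := natDegree_mul_le (p := Q) (q := legendre (m - 1))
      rw [natDegree_legendre] at h2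
      rw [List.sum_cons]
      omega
    · rw [List.cons_append, hQ m _ hm.1 hm.2, ← mul_assoc, hQ' n v hn hnN]

/-- An iterated integral of shifted Legendre polynomials over `[0, 1]` vanishes if one of the
indices is too large in comparison with the others. -/
theorem eval_one_legendreIterated_eq_zero {N : ℕ} {l : List ℕ} (hl : ∀ n ∈ l, 1 ≤ n ∧ n ≤ N)
    {n : ℕ} (hn : n ∈ l) (h : 1 + l.sum < 2 * n) : (legendreIterated N l).eval 1 = 0 := by
  obtain ⟨u, v, rfl⟩ := List.append_of_mem hn
  have hn' := hl n hn
  have hv := natDegree_legendreIterated_le (l := v) (N := N) fun m hm => hl m (by simp [hm])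
  -- By `h`, the cofactor of `P_{n-1}` has degree at most `u.sum + v.sum < n - 1`.
  have key : ∀ Q : ℝ[X], Q.natDegree ≤ u.sum →
      unitIntegral (Q * (legendre (n - 1) * legendreIterated N v)) = 0 := fun Q hQ => by
    rw [mul_left_comm]
    refine unitIntegral_legendre_mul (natDegree_mul_le.trans_lt ?_)
    simp only [List.sum_append, List.sum_cons] at h
    omega
  have hint : ∀ m w, 1 ≤ m → m ≤ N → (legendreIterated N (m :: w)).eval 1 =
      unitIntegral (legendre (m - 1) * legendreIterated N w) := fun m w hm hmN => by
    rw [← derivative_legendreIterated_cons hm hmN, unitIntegral_derivative,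
      eval_zero_legendreIterated_cons, sub_zero]
  cases u with
  | nil =>
    rw [List.nil_append, hint n v hn'.1 hn'.2]
    simpa using key 1 (by simp)
  | cons m u =>
    have hm := hl m (by simp)
    obtain ⟨Q, hQd, hQ⟩ := exists_unitIntegral_legendreIterated_append (N := N) (u := u)
      (fun k hk => hl k (by simp [hk])) (legendre (m - 1))
    rw [List.cons_append, hint m _ hm.1 hm.2, hQ n v hn'.1 hn'.2]
    refine key Q ?_
    rw [natDegree_legendre] at hQd
    rw [List.sum_cons]
    omega

end Iterated

/-! ### Order conditions from nilpotent matrices. -/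

section Representation

attribute [local instance] Matrix.linftyOpNormedRing Matrix.linftyOpNormedAlgebra

open WordSeries

theorem norm_apply_le_linftyOpNorm {m n : Type*} [Fintype m] [Fintype n] (B : Matrix m n ℂ)
    (i : m) (j : n) :
    ‖B i j‖ ≤ @norm _ (Matrix.linftyOpNormedAddCommGroup (m := m) (n := n) (α := ℂ)).toNorm B := by
  rw [Matrix.linfty_opNorm_def, ← coe_nnnorm, NNReal.coe_le_coe]
  exact (Finset.single_le_sum (f := fun j => ‖B i j‖₊) (fun _ _ => zero_le)
    (Finset.mem_univ j)).trans
    (Finset.le_sup (f := fun i => ∑ j, ‖B i j‖₊) (Finset.mem_univ i))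

theorem not_hasOrder_pow {k m : ℕ} (h : k < m) : ¬ HasOrder (fun δ : ℝ => δ ^ k) m := by
  intro h1
  have h2 : (fun δ : ℝ => δ ^ m) =o[𝓝[>] 0] fun δ : ℝ => δ ^ k :=
    (isLittleO_pow_pow h).mono nhdsWithin_le_nhds
  refine isLittleO_irrefl (Eventually.frequently ?_) (IsBigO.trans_isLittleO h1 h2)
  filter_upwards [self_mem_nhdsWithin] with δ hδ
  exact pow_ne_zero _ (ne_of_gt hδ)

theorem HasOrder.matrix_apply {m k : ℕ} {F : ℝ → Matrix (Fin m) (Fin m) ℂ} (h : HasOrder F k)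
    (i j : Fin m) : HasOrder (fun δ => F δ i j) k := by
  refine IsBigO.trans (IsBigO.of_bound 1 (Eventually.of_forall fun δ => ?_)) h
  rw [_root_.one_mul]
  exact norm_apply_le_linftyOpNorm _ _ _

/-- The strictly upper triangular matrices representing the letters, for which the upper right
corner of the value of a word series is the coefficient of the word `l`. -/
def wordMatrix (l : List ℕ) (n : ℕ) : Matrix (Fin (l.length + 1)) (Fin (l.length + 1)) ℂ :=
  Matrix.of fun i j => if (i : ℕ) + 1 = j ∧ l[(i : ℕ)]? = some n then 1 else 0

/-- Row `i` is nonzero only for the letter `l[i]`, and multiplication then passes to row `i + 1`: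
the matrices read the word `l` from position `i` on. -/
theorem evalTrunc_succ_wordMatrix_apply (N k : ℕ) (T : WordSeries) {l : List ℕ}
    (hl : ∀ n ∈ l, 1 ≤ n ∧ n ≤ N) (t : ℝ) (i j : Fin (l.length + 1)) :
    evalTrunc N (k + 1) T (fun n => t ^ n • wordMatrix l n) i j =
      (if i = j then (T [] : ℂ) else 0) + if h : (i : ℕ) < l.length then
        (t : ℂ) ^ l[(i : ℕ)] * evalTrunc N k (fun v => T (l[(i : ℕ)] :: v)) (fun n => t ^ n • wordMatrix l n)
          ⟨i + 1, by omega⟩ j else 0 := by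
  rw [evalTrunc, Matrix.add_apply, Matrix.sum_apply]
  congr 1
  · simp [Matrix.one_apply]
  · split_ifs with h
    · rw [Finset.sum_eq_single_of_mem l[(i : ℕ)] (Finset.mem_Icc.2 (hl _ (List.getElem_mem _)))]
      · rw [Matrix.mul_apply, Finset.sum_eq_single (⟨i + 1, by omega⟩ : Fin (l.length + 1))]
        · simp [wordMatrix]
        · intro p _ hp
          have : ¬ ((i : ℕ) + 1 = p) := fun h => hp (Fin.ext h.symm)
          simp [wordMatrix, this]
        · simp
      · intro n _ hn
        rw [Matrix.mul_apply]
        refine Finset.sum_eq_zero fun p _ => ?_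
        have : ¬ (l[(i : ℕ)] = n) := fun h => hn h.symm
        simp [wordMatrix, h, this]
    · refine Finset.sum_eq_zero fun n _ => ?_
      rw [Matrix.mul_apply]
      refine Finset.sum_eq_zero fun p _ => ?_
      have : ¬ ((i : ℕ) + 1 = p) := by omega
      simp [wordMatrix, this]

theorem evalTrunc_wordMatrix_last (N k : ℕ) (T : WordSeries) {l : List ℕ}
    (hl : ∀ n ∈ l, 1 ≤ n ∧ n ≤ N) (t : ℝ) (i : Fin (l.length + 1)) (hi : l.length ≤ i + k) :
    evalTrunc N k T (fun n => t ^ n • wordMatrix l n) i (Fin.last _) =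
      ((T (l.drop i) * t ^ (l.drop i).sum : ℝ) : ℂ) := by
  induction k generalizing T i with
  | zero =>
    have : i = Fin.last _ := Fin.ext (by simp; omega)
    subst this
    simp [evalTrunc]
  | succ k ih =>
    rw [evalTrunc_succ_wordMatrix_apply N k T hl]
    split_ifs with h1 h2 h2
    · simp [h1] at h2
    · simp [h1]
    · rw [ih _ _ (by simp; omega), List.drop_eq_getElem_cons h2, List.sum_cons, pow_add]
      push_cast
      ring
    · exact absurd (Fin.ext (by simp; omega)) h1

/-- Products of more than `l.length` of these matrices vanish, so the truncated Dyson series is an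
exact propagator. -/
theorem evalTrunc_succ_wordMatrix (N : ℕ) {l : List ℕ} (hl : ∀ n ∈ l, 1 ≤ n ∧ n ≤ N) (t : ℝ)
    (T : WordSeries) : evalTrunc N (l.length + 1) T (fun n => t ^ n • wordMatrix l n) =
      evalTrunc N l.length T (fun n => t ^ n • wordMatrix l n) := by
  suffices ∀ k (i : Fin (l.length + 1)) (j) (T : WordSeries), l.length ≤ i + k →
      evalTrunc N (k + 1) T (fun n => t ^ n • wordMatrix l n) i j =
      evalTrunc N k T (fun n => t ^ n • wordMatrix l n) i j by
    ext i j
    exact this _ i j T (by omega)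
  intro k
  induction k with
  | zero =>
    intro i j T hi
    rw [evalTrunc_succ_wordMatrix_apply N _ T hl, dif_neg (by omega)]
    simp [evalTrunc, Matrix.one_apply]
  | succ k ih =>
    intro i j T hi
    rw [evalTrunc_succ_wordMatrix_apply N _ T hl, evalTrunc_succ_wordMatrix_apply N _ T hl]
    congr 1
    split_ifs with h
    · rw [ih _ _ _ (by simp; omega)]
    · rfl

theorem isPropagator_wordMatrix (N : ℕ) {l : List ℕ} (hl : ∀ n ∈ l, 1 ≤ n ∧ n ≤ N) :
    IsPropagator (fun t : ℝ => ∑ j ∈ Finset.Icc 1 N, t ^ (j - 1) • wordMatrix l j)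
      fun t => evalTrunc N l.length dyson fun n => t ^ n • wordMatrix l n := by
  refine ⟨?_, Eventually.of_forall fun t => ?_⟩
  · beta_reduce
    rw [evalTrunc_zero_letters, dyson, one_smul]
    intro n hn
    rw [zero_pow (by have := (Finset.mem_Icc.1 hn).1; omega), zero_smul]
  · have h := hasDerivAt_evalTrunc_dyson N l.length (wordMatrix l) t
    simpa only [evalTrunc_succ_wordMatrix N hl] using h

/-- The order conditions: a commutator-free product of order `N` has the same coefficients as the
propagator. -/
theorem IsCFET.prodExp_eq_dyson {N s : ℕ} {f : Fin s → ℕ → ℝ} (hf : IsCFET N f) {l : List ℕ}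
    (hl : ∀ n ∈ l, 1 ≤ n ∧ n ≤ N) (hsum : l.sum ≤ N) :
    prodExp N (taylorWeight (N / 2 + 1) f) l = dyson l := by
  have : CompleteSpace (Matrix (Fin (l.length + 1)) (Fin (l.length + 1)) ℂ) :=
    FiniteDimensional.complete ℝ _
  have hE := hasExpansion_polynomial (wordMatrix l) N
  have hU := isPropagator_wordMatrix N hl
  have h1 : HasOrder _ (N + 1) := hf _ _ _ (by fun_prop) hU
  -- The CFET and the propagator cancel, leaving the difference of the two truncated series.
  have h2 := (h1.sub (hE.hasOrder_cfet_sub (N / 2 + 1) f)).add (hE.hasOrder_propagator_sub hU)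
  have hlen : l.length ≤ N :=
    (List.length_le_sum_of_one_le l fun n hn => (hl n hn).1).trans hsum
  have h3 : HasOrder (fun δ : ℝ => ((((prodExp N (taylorWeight (N / 2 + 1) f) l - dyson l) *
      δ ^ l.sum : ℝ)) : ℂ)) (N + 1) := by
    refine (h2.matrix_apply 0 (Fin.last _)).congr_left fun δ _ => ?_
    have hent : ∀ T : WordSeries,
        evalTrunc N N T (fun n => δ ^ n • wordMatrix l n) 0 (Fin.last _) =
        ((T l * δ ^ l.sum : ℝ) : ℂ) := fun T => by
      have := evalTrunc_wordMatrix_last N N T hl δ 0 (by simpa using hlen)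
      simpa using this
    simp only [Matrix.add_apply, Matrix.sub_apply]
    rw [hent, hent, sub_mul, Complex.ofReal_sub]
    abel
  have h4 : HasOrder (fun δ : ℝ => (prodExp N (taylorWeight (N / 2 + 1) f) l - dyson l) *
      δ ^ l.sum) (N + 1) := by
    refine IsBigO.trans (IsBigO.of_bound 1 (Eventually.of_forall fun δ => ?_)) h3
    rw [Complex.norm_real, _root_.one_mul]
  by_contra hne
  -- If the coefficients differed, `δ ^ l.sum` would be `O(δ^(N+1))`; the factor `δ ^ (N - l.sum)`
  -- brings this to the impossible `δ^N = O(δ^(N+1))`.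
  have h5 : HasOrder (fun δ : ℝ => δ ^ N) (N + 1) := by
    have h6 := (h4.smul_const (prodExp N (taylorWeight (N / 2 + 1) f) l - dyson l)⁻¹).mul
      (HasOrder.pow_smul_const (k := N - l.sum) (1 : ℝ))
    refine (h6.mono (by omega)).congr_left fun δ _ => ?_
    rw [smul_eq_mul, smul_eq_mul, mul_one, ← mul_assoc, inv_mul_cancel₀ (sub_ne_zero.2 hne),
      _root_.one_mul, ← pow_add, Nat.add_sub_cancel' hsum]
  exact not_hasOrder_pow (Nat.lt_succ_self N) h5

end Representation

/-! ### The index condition for contributing words. -/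

open WordSeries

theorem indexCondition_iff {l : List ℕ} : IndexCondition l ↔ ∀ n ∈ l, 2 * n ≤ 1 + l.sum := by
  refine forall₂_congr fun n hn => ?_
  have := List.sum_erase hn
  omega

theorem IsCFET.prodExp_eq_zero {N s : ℕ} {f : Fin s → ℕ → ℝ} (hf : IsCFET N f) (hN2 : 2 ≤ N)
    {l : List ℕ} (hl : ¬ IndexCondition l) : prodExp (N / 2 + 1) f l = 0 := by
  by_cases hr : ∃ n ∈ l, ¬ (1 ≤ n ∧ n ≤ N / 2 + 1)
  · exact prodExp_eq_zero_of_not_mem f l hr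
  push Not at hr
  rw [indexCondition_iff] at hl
  push Not at hl
  obtain ⟨n, hn, h⟩ := hl
  have hnM := (hr n hn).2
  have hr' : ∀ n ∈ l, 1 ≤ n ∧ n ≤ N := fun m hm => ⟨(hr m hm).1, (hr m hm).2.trans (by omega)⟩
  rw [← subst_prodExp N legendreMatrix (fun i m hm hmM =>
      sum_legendreMatrix_mul_taylorWeight (by omega) f i m hm hmM) hr,
    subst_congr N legendreMatrix (T := dyson), ← eval_one_legendreIterated,
    eval_one_legendreIterated_eq_zero hr' hn h]
  · intro m hm j hmj
    have := (hr m hm).1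
    exact Polynomial.coeff_eq_zero_of_natDegree_lt (by rw [natDegree_legendre]; omega)
  -- The violation gives `l.sum ≤ 2n - 2 ≤ N`, so the order conditions apply to all words involved.
  · exact fun v hv hs => hf.prodExp_eq_dyson hv (by omega)

theorem IsCFET.indexCondition_of_formalExponent_ne_zero {N s : ℕ} {f : Fin s → ℕ → ℝ}
    (hf : IsCFET N f) (hN2 : 2 ≤ N) {l : List ℕ} (hl : formalExponent (N / 2 + 1) f l ≠ 0) :
    IndexCondition l := by
  by_contra h
  refine hl (log_eq_zero_of (V := fun l => ¬ IndexCondition l) ?_ ?_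
    (fun v hv => hf.prodExp_eq_zero hN2 hv) l h)
  · intro l j hl
    simp only [indexCondition_iff] at hl ⊢
    push Not at hl ⊢
    obtain ⟨n, hn, h⟩ := hl
    have hs : l.sum = (l.take j).sum + (l.drop j).sum := by
      rw [← List.sum_append, List.take_append_drop]
    rw [← List.take_append_drop j l, List.mem_append] at hn
    exact hn.imp (fun hn => ⟨n, hn, by omega⟩) fun hn => ⟨n, hn, by omega⟩
  · simp [IndexCondition]

/-! ### Effect of the quadrature on commutators and on the CFET. -/

section Orders

variable {𝔸 : Type*} [NormedRing 𝔸]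

theorem HasOrder.mul_sub_mul {X X' Y Y' : ℝ → 𝔸} {p q k : ℕ} (hX : HasOrder X p)
    (hY' : HasOrder Y' q) (hdX : HasOrder (fun δ => X' δ - X δ) (k - q))
    (hdY : HasOrder (fun δ => Y' δ - Y δ) (k - p)) :
    HasOrder (fun δ => X' δ * Y' δ - X δ * Y δ) k := by
  refine (((hdX.mul hY').mono (m := k) (by omega)).add
    ((hX.mul hdY).mono (m := k) (by omega))).congr_left fun δ _ => ?_
  noncomm_ring

/-- Coefficients `a_n = O(δ^n)` and approximations of them with errors `O(δ^{N+4-n})`, for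
`1 ≤ n ≤ N/2+1`. -/
structure IsApproximation (N : ℕ) (a' a : ℝ → ℕ → 𝔸) : Prop where
  hasOrder : ∀ n, 1 ≤ n → n ≤ N / 2 + 1 → HasOrder (fun δ => a δ n) n
  hasOrder_sub : ∀ n, 1 ≤ n → n ≤ N / 2 + 1 → HasOrder (fun δ => a' δ n - a δ n) (N + 4 - n)

namespace IsApproximation

variable {N : ℕ} {a' a : ℝ → ℕ → 𝔸}

theorem hasOrder' (h : IsApproximation N a' a) (n : ℕ) (hn : 1 ≤ n) (hnM : n ≤ N / 2 + 1) :
    HasOrder (fun δ => a' δ n) n :=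
  (((h.hasOrder_sub n hn hnM).mono (by omega)).add (h.hasOrder n hn hnM)).congr_left
    fun _ _ => sub_add_cancel _ _

theorem self (h : IsApproximation N a' a) : IsApproximation N a' a' :=
  ⟨h.hasOrder', fun n _ _ => by simpa using HasOrder.zero⟩

theorem hasOrder_prod (h : IsApproximation N a' a) {u : List ℕ}
    (hu : ∀ n ∈ u, 1 ≤ n ∧ n ≤ N / 2 + 1) : HasOrder (fun δ => (u.map (a δ)).prod) u.sum := by
  induction u with
  | nil => simpa using HasOrder.const (1 : 𝔸)
  | cons n u ih =>
    simp only [List.map_cons, List.prod_cons, List.sum_cons]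
    have hn := hu n List.mem_cons_self
    exact (h.hasOrder n hn.1 hn.2).mul (ih fun m hm => hu m (List.mem_cons_of_mem _ hm))

/-- The bound on `k` says that an error `N+4-n` in one letter, times the orders of the others, still
has order `k`. For `k = N + 3` it is the index condition. -/
theorem hasOrder_prod_sub (h : IsApproximation N a' a) {u : List ℕ}
    (hu : ∀ n ∈ u, 1 ≤ n ∧ n ≤ N / 2 + 1) {k : ℕ} (hk : ∀ n ∈ u, k + 2 * n ≤ N + 4 + u.sum) :
    HasOrder (fun δ => (u.map (a' δ)).prod - (u.map (a δ)).prod) k := by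
  induction u generalizing k with
  | nil => simpa using HasOrder.zero
  | cons n u ih =>
    simp only [List.map_cons, List.prod_cons]
    have hn := hu n List.mem_cons_self
    have hu' : ∀ m ∈ u, 1 ≤ m ∧ m ≤ N / 2 + 1 := fun m hm => hu m (List.mem_cons_of_mem _ hm)
    have hk0 := hk n List.mem_cons_self
    rw [List.sum_cons] at hk0
    refine (h.hasOrder n hn.1 hn.2).mul_sub_mul (h.self.hasOrder_prod hu')
      ((h.hasOrder_sub n hn.1 hn.2).mono (by omega)) (ih hu' fun m hm => ?_)
    have h1 := hk m (List.mem_cons_of_mem _ hm)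
    -- Needed when `k < n`, where the truncated difference `k - n` is `0` and the bound reduces to
    -- `2m ≤ N + 4 + u.sum`.
    have h2 := (hu' m hm).2
    rw [List.sum_cons] at h1
    omega

theorem hasOrder_nestedComm (h : IsApproximation N a' a) {b : FreeMagma ℕ}
    (hb : ∀ n ∈ letters b, 1 ≤ n ∧ n ≤ N / 2 + 1) :
    HasOrder (fun δ => nestedComm (a δ) b) (letters b).sum := by
  induction b using FreeMagma.rec with
  | of n =>
    have hn := hb n (by simp [letters])
    simpa [nestedComm, letters] using h.hasOrder n hn.1 hn.2
  | mul b c ihb ihc =>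
    have h1 := ihb fun n hn => hb n (List.mem_append_left _ hn)
    have h2 := ihc fun n hn => hb n (List.mem_append_right _ hn)
    rw [letters, List.sum_append]
    exact (h1.mul h2).sub ((h2.mul h1).mono (by omega))

theorem hasOrder_nestedComm_sub (h : IsApproximation N a' a) {b : FreeMagma ℕ}
    (hb : ∀ n ∈ letters b, 1 ≤ n ∧ n ≤ N / 2 + 1) {k : ℕ}
    (hk : ∀ n ∈ letters b, k + 2 * n ≤ N + 4 + (letters b).sum) :
    HasOrder (fun δ => nestedComm (a' δ) b - nestedComm (a δ) b) k := by
  induction b using FreeMagma.rec generalizing k with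
  | of n =>
    have hn := hb n (by simp [letters])
    have hk0 := hk n (by simp [letters])
    simp only [letters, List.sum_singleton] at hk0
    exact (h.hasOrder_sub n hn.1 hn.2).mono (by omega)
  | mul b c ihb ihc =>
    have hb1 : ∀ n ∈ letters b, 1 ≤ n ∧ n ≤ N / 2 + 1 :=
      fun n hn => hb n (List.mem_append_left _ hn)
    have hb2 : ∀ n ∈ letters c, 1 ≤ n ∧ n ≤ N / 2 + 1 :=
      fun n hn => hb n (List.mem_append_right _ hn)
    have hs : (letters (FreeMagma.mul b c)).sum = (letters b).sum + (letters c).sum := by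
      rw [letters, List.sum_append]
    rw [hs] at hk
    have d1 := ihb hb1 (k := k - (letters c).sum) fun n hn => by
      have := hk n (List.mem_append_left _ hn)
      have := hb1 n hn
      omega
    have d2 := ihc hb2 (k := k - (letters b).sum) fun n hn => by
      have := hk n (List.mem_append_right _ hn)
      have := hb2 n hn
      omega
    have e1 := (h.hasOrder_nestedComm hb1).mul_sub_mul (h.self.hasOrder_nestedComm hb2) d1 d2
    have e2 := (h.hasOrder_nestedComm hb2).mul_sub_mul (h.self.hasOrder_nestedComm hb1) d2 d1
    refine (e1.sub e2).congr_left fun δ _ => ?_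
    simp only [nestedComm]
    abel

/-- The prefix `u` stores the letters already read, since the index condition concerns the whole
word and not its tail. -/
theorem hasOrder_prod_mul_evalTrunc_sub [NormedAlgebra ℝ 𝔸] (h : IsApproximation N a' a) {T : WordSeries}
    {u : List ℕ} (hu : ∀ n ∈ u, 1 ≤ n ∧ n ≤ N / 2 + 1)
    (hT : ∀ v, T v ≠ 0 → IndexCondition (u ++ v)) (k : ℕ) :
    HasOrder (fun δ => (u.map (a' δ)).prod * evalTrunc (N / 2 + 1) k T (a' δ)
      - (u.map (a δ)).prod * evalTrunc (N / 2 + 1) k T (a δ)) (N + 3) := by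
  have hbase : ∀ {T : WordSeries} {u : List ℕ}, (∀ n ∈ u, 1 ≤ n ∧ n ≤ N / 2 + 1) →
      (∀ v, T v ≠ 0 → IndexCondition (u ++ v)) →
      HasOrder (fun δ => (u.map (a' δ)).prod * (T [] • 1) - (u.map (a δ)).prod * (T [] • 1))
        (N + 3) := fun {T u} hu hT => by
    by_cases h0 : T [] = 0
    · simpa [h0] using HasOrder.zero
    · have h1 := hT [] h0
      rw [List.append_nil, indexCondition_iff] at h1
      refine ((h.hasOrder_prod_sub hu (k := N + 3) fun n hn => ?_).smul_const (T [])).congr_left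
        fun δ _ => ?_
      · have := h1 n hn
        omega
      · rw [mul_smul_comm, mul_smul_comm, mul_one, mul_one, smul_sub]
  induction k generalizing T u with
  | zero => exact hbase hu hT
  | succ k ih =>
    refine ((hbase hu hT).add (HasOrder.sum (s := Finset.Icc 1 (N / 2 + 1)) fun n hn =>
      ih (T := fun v => T (n :: v)) (u := u ++ [n]) ?_ ?_)).congr_left fun δ _ => ?_
    · intro m hm
      rcases List.mem_append.1 hm with hm | hm
      · exact hu m hm
      · rw [List.mem_singleton.1 hm]
        exact Finset.mem_Icc.1 hn
    · intro v hv
      simpa using hT (n :: v) hv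
    · simp only [evalTrunc, List.map_append, List.map_cons, List.map_nil, List.prod_append,
        List.prod_cons, List.prod_nil, mul_one, Finset.sum_sub_distrib, mul_add, Finset.mul_sum,
        mul_assoc]
      abel

end IsApproximation

variable [NormedAlgebra ℝ 𝔸]

theorem hasOrder_evalTrunc_of_eq_zero {N m : ℕ} {b : ℝ → ℕ → 𝔸}
    (hb : ∀ n ∈ Finset.Icc 1 N, HasOrder (fun δ => b δ n) n) (k : ℕ) {T : WordSeries}
    (hT : ∀ v : List ℕ, (∀ n ∈ v, 1 ≤ n ∧ n ≤ N) → v.sum < m → T v = 0) :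
    HasOrder (fun δ => evalTrunc N k T (b δ)) m := by
  have hbase : ∀ {m : ℕ} {T : WordSeries},
      (∀ v : List ℕ, (∀ n ∈ v, 1 ≤ n ∧ n ≤ N) → v.sum < m → T v = 0) →
      HasOrder (fun _ : ℝ => T [] • (1 : 𝔸)) m := fun {m T} hT => by
    rcases Nat.eq_zero_or_pos m with rfl | hm
    · exact HasOrder.const _
    · rw [hT [] (by simp) (by simpa using hm)]
      simpa using HasOrder.zero
  induction k generalizing T m with
  | zero => exact hbase hT
  | succ k ih =>
    refine (hbase hT).add (HasOrder.sum fun n hn => ((hb n hn).mul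
      (ih (m := m - n) (T := fun v => T (n :: v)) fun v hv hs => hT _ ?_ ?_)).mono (by omega))
    · simpa using ⟨Finset.mem_Icc.1 hn, hv⟩
    · rw [List.sum_cons]
      omega

/-- The order conditions are identities between real numbers, so what matrices reveal holds in every
Banach algebra: the two series differ only in weights above `N`. -/
theorem IsCFET.hasOrder_sub [CompleteSpace 𝔸] {N s : ℕ} {f : Fin s → ℕ → ℝ} (hf : IsCFET N f)
    {A U : ℝ → 𝔸} {a : ℕ → 𝔸} (h : HasExpansion A a N) (hU : IsPropagator A U) :
    HasOrder (fun δ => cfet (N / 2 + 1) f A δ - U δ) (N + 1) := by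
  have h1 := h.hasOrder_cfet_sub (N / 2 + 1) f
  have h2 := h.hasOrder_propagator_sub hU
  have h3 := hasOrder_evalTrunc_of_eq_zero (m := N + 1) (b := fun (δ : ℝ) n => δ ^ n • a n)
    (N := N) (fun n _ => HasOrder.pow_smul_const _) N
    (T := fun l => prodExp N (taylorWeight (N / 2 + 1) f) l + (-1) * dyson l) fun v hv hs => by
      rw [hf.prodExp_eq_dyson hv (by omega)]
      ring
  simp only [evalTrunc_add, evalTrunc_const_mul, neg_smul, one_smul] at h3
  refine ((h1.add h3).sub h2).congr_left fun δ _ => ?_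
  abel

theorem quadCfet_eq {M s : ℕ} (x w : Fin M → ℝ) (f : Fin s → ℕ → ℝ) (A : ℝ → 𝔸) (δ : ℝ) :
    quadCfet x w f A δ = (List.ofFn fun i : Fin s =>
      NormedSpace.exp (∑ n ∈ Finset.Icc 1 M, f i n • quadCoeff x w A n δ)).prod := by
  rw [quadCfet]
  congr 3
  funext i
  congr 1
  simp only [quadCoeff, quadWeight, Finset.smul_sum, smul_smul, Finset.mul_sum, Finset.sum_smul]
  rw [Finset.sum_comm]
  refine Finset.sum_congr rfl fun n _ => Finset.sum_congr rfl fun m _ => ?_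
  congr 1
  ring

theorem isApproximation_quadCoeff [CompleteSpace 𝔸] {N : ℕ} (hN : Even N)
    {x w : Fin (N / 2 + 1) → ℝ} (hxw : IsGaussLegendre (N / 2 + 1) x w) {A : ℝ → 𝔸} {a : ℕ → 𝔸}
    (hA : ∀ K, HasExpansion A a K) : IsApproximation N (fun δ n => quadCoeff x w A n δ)
      fun δ n => legendreCoeff A n δ where
  hasOrder n _ _ := HasExpansion.hasOrder_legendreCoeff hA n
  hasOrder_sub n hn hnM := by
    have h := HasExpansion.hasOrder_quadCoeff_sub_legendreCoeff hA hxw hn hnM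
    rwa [show 2 * (N / 2 + 1) + 2 - n = N + 4 - n by have := Nat.two_mul_div_two_of_even hN; omega]
      at h

/-- Both products are values of the same series `prodExp`, up to words longer than `N + 2`, and this
series is supported on words satisfying the index condition. -/
theorem IsCFET.hasOrder_quadCfet_sub [CompleteSpace 𝔸] {N s : ℕ} (hN : Even N) (hN2 : 2 ≤ N)
    {f : Fin s → ℕ → ℝ} (hf : IsCFET N f) {x w : Fin (N / 2 + 1) → ℝ}
    (hxw : IsGaussLegendre (N / 2 + 1) x w) {A : ℝ → 𝔸} {a : ℕ → 𝔸}
    (hA : ∀ K, HasExpansion A a K) :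
    HasOrder (fun δ => quadCfet x w f A δ - cfet (N / 2 + 1) f A δ) (N + 3) := by
  have h := isApproximation_quadCoeff hN hxw hA
  have h1 := hasOrder_prod_exp_sub_evalTrunc (M := N / 2 + 1) (fun n hn =>
    (h.hasOrder n (Finset.mem_Icc.1 hn).1 (Finset.mem_Icc.1 hn).2).mono (Finset.mem_Icc.1 hn).1)
    (N + 2) f (Ω := fun i δ => ∑ n ∈ Finset.Icc 1 (N / 2 + 1), f i n • legendreCoeff A n δ)
    fun i => by simpa using HasOrder.zero
  have h2 := hasOrder_prod_exp_sub_evalTrunc (M := N / 2 + 1) (fun n hn =>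
    (h.hasOrder' n (Finset.mem_Icc.1 hn).1 (Finset.mem_Icc.1 hn).2).mono (Finset.mem_Icc.1 hn).1)
    (N + 2) f (Ω := fun i δ => ∑ n ∈ Finset.Icc 1 (N / 2 + 1), f i n • quadCoeff x w A n δ)
    fun i => by simpa using HasOrder.zero
  have h3 := h.hasOrder_prod_mul_evalTrunc_sub (T := prodExp (N / 2 + 1) f) (u := []) (by simp)
    (fun v hv => by
      by_contra hc
      exact hv (hf.prodExp_eq_zero hN2 hc)) (N + 2)
  refine ((h2.add h3).sub h1).congr_left fun δ _ => ?_
  rw [quadCfet_eq, cfet]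
  simp

theorem IsGaussLegendre.exists_not_hasOrder {N : ℕ} (hN : Even N) {x w : Fin (N / 2 + 1) → ℝ}
    (hxw : IsGaussLegendre (N / 2 + 1) x w) {n : ℕ} (hn : 1 ≤ n) (hnM : n ≤ N / 2 + 1) :
    ∃ A : ℝ → ℝ, AnalyticAt ℝ A 0 ∧
      ¬ HasOrder (fun δ => quadCoeff x w A n δ - legendreCoeff A n δ) (N + 5 - n) := by
  have hN' := Nat.two_mul_div_two_of_even hN
  -- The power for which `P_{n-1}` times the monomial has degree exactly `2M = N + 2`, the first
  -- degree where the rule fails.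
  refine ⟨fun t => t ^ (N + 3 - n), by fun_prop, fun h => ?_⟩
  have hA : HasExpansion (fun t : ℝ => t ^ (N + 3 - n))
      (fun j => if j = N + 4 - n then (1 : ℝ) else 0) (N + 4 - n) := by
    refine ⟨Eventually.of_forall fun t => by fun_prop, ?_⟩
    have : ∀ t : ℝ, t ^ (N + 3 - n) - ∑ j ∈ Finset.Icc 1 (N + 4 - n),
        t ^ (j - 1) • (if j = N + 4 - n then (1 : ℝ) else 0) = 0 := fun t => by
      rw [Finset.sum_eq_single_of_mem (N + 4 - n) (Finset.mem_Icc.2 (by omega)) fun j _ hj => by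
        rw [if_neg hj, smul_zero], if_pos rfl, smul_eq_mul, mul_one,
        show N + 4 - n - 1 = N + 3 - n by omega, sub_self]
    simpa only [this] using isBigO_zero _ _
  have h1 := (hA.hasOrder_quadCoeff_sub x w n).sub (hA.hasOrder_legendreCoeff_sub n)
  rw [show N + 4 - n + 1 = N + 5 - n by omega] at h1
  set q : Polynomial ℝ := legendre (n - 1) * Polynomial.X ^ (N + 3 - n) with hq
  have hqd : q.natDegree = 2 * (N / 2 + 1) := by
    have h0 : legendre (n - 1) ≠ 0 := fun h0 => by
      have := coeff_legendre_pos (n - 1)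
      simp [h0] at this
    rw [hq, Polynomial.natDegree_mul_X_pow _ h0, natDegree_legendre]
    omega
  have hc : (2 * (n : ℝ) - 1) * (quadSum x w q - unitIntegral q) ≠ 0 := by
    refine mul_ne_zero ?_ (hxw.quadSum_ne (by omega) hqd)
    have : (1 : ℝ) ≤ n := by exact_mod_cast hn
    linarith
  refine not_hasOrder_pow (k := N + 4 - n) (m := N + 5 - n) (by omega)
    (((h.sub h1).smul_const ((2 * (n : ℝ) - 1) *
      (quadSum x w q - unitIntegral q))⁻¹).congr_left fun δ _ => ?_)
  have hsum : ∀ c : ℕ → ℝ, ∑ j ∈ Finset.Icc 1 (N + 4 - n),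
      c j • (δ ^ j • if j = N + 4 - n then (1 : ℝ) else 0) =
      c (N + 4 - n) * δ ^ (N + 4 - n) := fun c => by
    rw [Finset.sum_eq_single_of_mem (N + 4 - n) (Finset.mem_Icc.2 (by omega)) fun j _ hj => by
      rw [if_neg hj, smul_zero, smul_zero], if_pos rfl, smul_eq_mul, smul_eq_mul, mul_one]
  rw [hsum, hsum, show N + 4 - n - 1 = N + 3 - n by omega, ← hq, smul_eq_mul]
  rw [inv_mul_eq_iff_eq_mul₀ hc]
  ring

end Orders

end GaussCFET

end

theorem mainTheorem7 (N : ℕ) (hN : Even N) (hN2 : 2 ≤ N)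
    (x w : Fin (N / 2 + 1) → ℝ) (hxw : GaussCFET.IsGaussLegendre (N / 2 + 1) x w)
    {s : ℕ} (f : Fin s → ℕ → ℝ) (hf : GaussCFET.IsCFET N f) :
    -- the indices of a contributing commutator satisfy the index condition
    (∀ l : List ℕ, GaussCFET.formalExponent (N / 2 + 1) f l ≠ 0 → GaussCFET.IndexCondition l) ∧
    -- the exponent in the error estimate for the coefficients cannot be improved
    (∀ n : ℕ, 1 ≤ n → n ≤ N / 2 + 1 → ∃ A : ℝ → ℝ, AnalyticAt ℝ A 0 ∧
      ¬ ((fun δ => GaussCFET.quadCoeff x w A n δ - GaussCFET.legendreCoeff A n δ)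
          =O[𝓝[>] (0 : ℝ)] fun δ => δ ^ (N + 5 - n))) ∧
    ∀ {𝔸 : Type*} [NormedRing 𝔸] [NormedAlgebra ℝ 𝔸] [CompleteSpace 𝔸] (A : ℝ → 𝔸),
      AnalyticAt ℝ A 0 →
      -- the errors of the coefficients
      (∀ n : ℕ, 1 ≤ n → n ≤ N / 2 + 1 →
        (fun δ => GaussCFET.quadCoeff x w A n δ - GaussCFET.legendreCoeff A n δ)
          =O[𝓝[>] (0 : ℝ)] fun δ => δ ^ (N + 4 - n)) ∧
      -- the errors of the nested commutators
      (∀ b : FreeMagma ℕ, (∀ n ∈ GaussCFET.letters b, 1 ≤ n ∧ n ≤ N / 2 + 1) →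
        GaussCFET.IndexCondition (GaussCFET.letters b) →
        (fun δ => GaussCFET.nestedComm (fun n => GaussCFET.quadCoeff x w A n δ) b
            - GaussCFET.nestedComm (fun n => GaussCFET.legendreCoeff A n δ) b)
          =O[𝓝[>] (0 : ℝ)] fun δ => δ ^ (N + 3)) ∧
      -- the change of the CFET
      ((fun δ => GaussCFET.quadCfet x w f A δ - GaussCFET.cfet (N / 2 + 1) f A δ)
          =O[𝓝[>] (0 : ℝ)] fun δ => δ ^ (N + 3)) ∧
      -- the order of the CFET
      (∀ U : ℝ → 𝔸, GaussCFET.IsPropagator A U →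
        ((fun δ => GaussCFET.quadCfet x w f A δ - U δ)
          =O[𝓝[>] (0 : ℝ)] fun δ => δ ^ (N + 1)) ∧
        ∀ p : ℕ, p ≤ N + 3 →
          (((fun δ => GaussCFET.quadCfet x w f A δ - U δ) =O[𝓝[>] (0 : ℝ)] fun δ => δ ^ p) ↔
            ((fun δ => GaussCFET.cfet (N / 2 + 1) f A δ - U δ)
              =O[𝓝[>] (0 : ℝ)] fun δ => δ ^ p))) := by
  refine ⟨fun l hl => hf.indexCondition_of_formalExponent_ne_zero hN2 hl,
    fun n hn hnM => hxw.exists_not_hasOrder hN hn hnM, ?_⟩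
  intro 𝔸 _ _ _ A hA
  obtain ⟨a, ha⟩ := hA.exists_hasExpansion
  have happ := GaussCFET.isApproximation_quadCoeff hN hxw ha
  have hquad := hf.hasOrder_quadCfet_sub hN hN2 hxw ha
  refine ⟨happ.hasOrder_sub, fun b hb hP => ?_, hquad, fun U hU => ⟨?_, fun p hp => ?_⟩⟩
  · refine happ.hasOrder_nestedComm_sub hb (k := N + 3) fun n hn => ?_
    have := GaussCFET.indexCondition_iff.1 hP n hn
    omega
  · exact ((hquad.mono (by omega)).add (hf.hasOrder_sub (ha N) hU)).congr_left fun _ _ =>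
      sub_add_sub_cancel _ _ _
  · refine ⟨fun h => ?_, fun h => ?_⟩
    · exact (GaussCFET.HasOrder.sub h (hquad.mono hp)).congr_left fun _ _ =>
        by abel
    · exact ((hquad.mono hp).add h).congr_left fun _ _ => sub_add_sub_cancel _ _ _
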